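/- Let $S\subset\mathbb Z$ be a finite set, let $P$ be an irreducible stochastic matrix on $S$ with stationary distribution $\nu$ (so $\nu P=\nu$), let $\mu$ be any probability distribution on $S$, and let $X_0,X_1,X_2,\dots$ be a Markov chain with state space $S$, initial distribution $\mu$ and transition matrix $P$, defined on a probability space $(\Omega,\mathbb P)$. Assume that $\sum_{s\in S}\nu(s)\,s=0$ and that the chain is strongly aperiodic, i.e. whenever $t\in\mathbb R$, $\lambda\in\mathbb C$ with $|\lambda|=1$ and $\varphi:S\to\mathbb C$ with $|\varphi|\equiv 1$ satisfy $e^{ity}=\lambda\,\varphi(x)/\varphi(y)$ for all $x,y\in S$ with $P(x,y)>0$, then $t\in 2\pi\mathbb Z$ and $\varphi$ is constant. Put $S_n=\sum_{k=0}^n X_k$, $L_n(x)=\#\{0\le k\le n: S_k=x\}$ for $x\in\mathbb Z$, and, for $n\ge 1$ and $x\in\mathbb R$, $$t_n(x)=\frac{1}{\sqrt n}\,L_n\big(\lfloor \sqrt n\,x\rfloor\big).$$ Let $D=D(\mathbb R)$ be the space of right-continuous functions $\mathbb R\to\mathbb R$ with left limits, with the Skorokhod $J_1$ topology (in which $f_n\to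 f$ if and only if there are increasing homeomorphisms $\lambda_n$ of $\mathbb R$ with $\sup_{t\in\mathbb R}|\lambda_n(t)-t|\to0$ and $\sup_{|t|\le m}|f_n(\lambda_n(t))-f(t)|\to0$ for every $m$) and its Borel $\sigma$-algebra. Then each $t_n$ is a $D$-valued random variable, and the sequence $(t_n)_{n\ge1}$ is tight in $D$: for every $\varepsilon>0$ there is a compact set $K\subset D$ with $\mathbb P(t_n\notin K)\le\varepsilon$ for all $n\ge1$. -/

import Mathlib

open MeasureTheory Filter Topology

/-! ### The Skorokhod space `D(ℝ)` -/

/-- A function `f : ℝ → ℝ` is càdlàg if it is right-continuous and has a (finite) left limit at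
every point. -/
def CadlagReal (f : ℝ → ℝ) : Prop :=
  ∀ x : ℝ, ContinuousWithinAt f (Set.Ici x) x ∧ ∃ l : ℝ, Tendsto f (𝓝[<] x) (𝓝 l)

/-- The space `D = D(ℝ)` of càdlàg functions `ℝ → ℝ`. -/
structure SkorokhodD where
  /-- the underlying function -/
  toFun : ℝ → ℝ
  /-- the underlying function is càdlàg -/
  cadlag : CadlagReal toFun

namespace SkorokhodD

instance : CoeFun SkorokhodD (fun _ => ℝ → ℝ) := ⟨SkorokhodD.toFun⟩

/-- The basic `J₁`-neighbourhood of `f` of parameters `m` and `ε`: all `g` for which there is an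
increasing homeomorphism `lam` of `ℝ` (a time change) with `|lam t - t| ≤ ε` for all `t`, and
`|g (lam t) - f t| ≤ ε` for all `|t| ≤ m`. -/
def basicNhd (f : SkorokhodD) (m ε : ℝ) : Set SkorokhodD :=
  {g | ∃ lam : ℝ ≃o ℝ, (∀ t : ℝ, |lam t - t| ≤ ε) ∧ ∀ t : ℝ, |t| ≤ m → |g (lam t) - f t| ≤ ε}

theorem basicNhd_mono (f : SkorokhodD) {m m' ε ε' : ℝ} (hm : m' ≤ m) (hε : ε ≤ ε') :
    f.basicNhd m ε ⊆ f.basicNhd m' ε' := by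
  rintro g ⟨lam, h1, h2⟩
  exact ⟨lam, fun t => (h1 t).trans hε, fun t ht => (h2 t (ht.trans hm)).trans hε⟩

theorem self_mem_basicNhd (f : SkorokhodD) (m : ℝ) {ε : ℝ} (hε : 0 ≤ ε) :
    f ∈ f.basicNhd m ε :=
  ⟨OrderIso.refl ℝ, fun t => by simpa using hε, fun t _ => by simpa using hε⟩

theorem basicNhd_trans {f g : SkorokhodD} {m ε : ℝ} (hg : g ∈ f.basicNhd m (ε / 2)) :
    g.basicNhd (m + ε / 2) (ε / 2) ⊆ f.basicNhd m ε := by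
  obtain ⟨lam, h1, h2⟩ := hg
  rintro h ⟨kap, h3, h4⟩
  refine ⟨lam.trans kap, fun t => ?_, fun t ht => ?_⟩
  · have ha := abs_le.1 (h1 t)
    have hb := abs_le.1 (h3 (lam t))
    rw [OrderIso.trans_apply, abs_le]
    constructor <;> linarith
  · have hl : |lam t| ≤ m + ε / 2 := by
      have ha := abs_le.1 (h1 t)
      have hb := abs_le.1 ht
      rw [abs_le]
      constructor <;> linarith
    have ha := abs_le.1 (h2 t ht)
    have hb := abs_le.1 (h4 (lam t) hl)
    rw [OrderIso.trans_apply, abs_le]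
    constructor <;> linarith

/-- The Skorokhod `J₁` topology on `D(ℝ)`: a set is open if with each of its points it contains a
basic `J₁`-neighbourhood of that point. -/
instance : TopologicalSpace SkorokhodD where
  IsOpen U := ∀ f ∈ U, ∃ m ε : ℝ, 0 < ε ∧ f.basicNhd m ε ⊆ U
  isOpen_univ := fun _ _ => ⟨0, 1, one_pos, Set.subset_univ _⟩
  isOpen_inter := by
    rintro U V hU hV f ⟨hfU, hfV⟩
    obtain ⟨m, ε, hε, h⟩ := hU f hfU
    obtain ⟨m', ε', hε', h'⟩ := hV f hfV
    exact ⟨max m m', min ε ε', lt_min hε hε', Set.subset_inter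
      ((f.basicNhd_mono (le_max_left _ _) (min_le_left _ _)).trans h)
      ((f.basicNhd_mono (le_max_right _ _) (min_le_right _ _)).trans h')⟩
  isOpen_sUnion := by
    rintro s hs f ⟨U, hU, hfU⟩
    obtain ⟨m, ε, hε, h⟩ := hs U hU f hfU
    exact ⟨m, ε, hε, h.trans (Set.subset_sUnion_of_mem hU)⟩

theorem isOpen_iff' {U : Set SkorokhodD} :
    IsOpen U ↔ ∀ f ∈ U, ∃ m ε : ℝ, 0 < ε ∧ f.basicNhd m ε ⊆ U := Iff.rfl

/-- The sets `basicNhd f m ε`, `ε > 0`, are a neighbourhood basis at `f`. Hence `fₙ → f` if and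
only if there are time changes `lamₙ` of `ℝ` with `lamₙ t - t → 0` uniformly on `ℝ` and
`fₙ (lamₙ t) → f t` uniformly on every `[-m, m]`. -/
theorem mem_nhds_iff_basicNhd {f : SkorokhodD} {A : Set SkorokhodD} :
    A ∈ 𝓝 f ↔ ∃ m ε : ℝ, 0 < ε ∧ f.basicNhd m ε ⊆ A := by
  constructor
  · intro hA
    obtain ⟨U, hUA, hU, hf⟩ := mem_nhds_iff.1 hA
    obtain ⟨m, ε, hε, h⟩ := isOpen_iff'.1 hU f hf
    exact ⟨m, ε, hε, h.trans hUA⟩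
  · rintro ⟨m, ε, hε, h⟩
    refine mem_nhds_iff.2 ⟨{g | ∃ m' ε' : ℝ, 0 < ε' ∧ g.basicNhd m' ε' ⊆ A}, ?_, ?_, m, ε, hε, h⟩
    · rintro g ⟨m', ε', hε', hg⟩
      exact hg (g.self_mem_basicNhd m' hε'.le)
    · rw [isOpen_iff']
      rintro g ⟨m', ε', hε', hg⟩
      exact ⟨m', ε' / 2, half_pos hε', fun k hk =>
        ⟨m' + ε' / 2, ε' / 2, half_pos hε', (basicNhd_trans hk).trans hg⟩⟩

/-- `D(ℝ)` carries the Borel `σ`-algebra of the `J₁` topology. -/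
instance : MeasurableSpace SkorokhodD := borel SkorokhodD

instance : BorelSpace SkorokhodD := ⟨rfl⟩

end SkorokhodD

/-! ### Finite-state integer-valued Markov chains -/

/-- Strong aperiodicity of the transition matrix `P` on the finite set `S` of integers: the only
solutions of `exp (i t y) = c * φ x / φ y` for all `x, y` with `P x y > 0`, where `t` is real,
`|c| = 1` and `|φ| ≡ 1`, have `t ∈ 2πℤ` and `φ` constant. -/
def StronglyAperiodic (S : Finset ℤ) (P : Matrix S S ℝ) : Prop :=
  ∀ (t : ℝ) (c : ℂ) (φ : S → ℂ), ‖c‖ = 1 → (∀ x, ‖φ x‖ = 1) →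
    (∀ x y : S, 0 < P x y →
      Complex.exp (Complex.I * (t : ℂ) * (((y : ℤ) : ℝ) : ℂ)) = c * (φ x / φ y)) →
    (∃ k : ℤ, t = 2 * Real.pi * (k : ℝ)) ∧ ∀ x y : S, φ x = φ y

/-- Under `ℙ`, the random variables `X 0, X 1, …` form a Markov chain with state space `S`,
initial distribution `μ` and transition matrix `P`. -/
def IsMarkovChain {Ω : Type*} [MeasurableSpace Ω] (ℙ : Measure Ω) (S : Finset ℤ)
    (P : Matrix S S ℝ) (μ : S → ℝ) (X : ℕ → Ω → S) : Prop :=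
  (∀ k, Measurable (X k)) ∧
    ∀ (n : ℕ) (s : ℕ → S),
      ℙ.real {ω | ∀ k ≤ n, X k ω = s k} = μ (s 0) * ∏ k ∈ Finset.range n, P (s k) (s (k + 1))

section LocalTime

variable {Ω : Type*} {S : Finset ℤ}

/-- `S_n = X_0 + X_1 + ⋯ + X_n`. -/
def partialSum (X : ℕ → Ω → S) (n : ℕ) (ω : Ω) : ℤ :=
  ∑ k ∈ Finset.range (n + 1), (X k ω : ℤ)

/-- `L_n(x)`, the number of `0 ≤ k ≤ n` with `S_k = x`. -/
def visitCount (X : ℕ → Ω → S) (n : ℕ) (x : ℤ) (ω : Ω) : ℕ :=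
  ((Finset.range (n + 1)).filter (fun k => partialSum X k ω = x)).card

/-- `t_n(x) = L_n(⌊√n x⌋) / √n`. -/
noncomputable def localTime (X : ℕ → Ω → S) (n : ℕ) (ω : Ω) (x : ℝ) : ℝ :=
  (visitCount X n ⌊√(n : ℝ) * x⌋ ω : ℝ) / √(n : ℝ)

theorem cadlag_comp_floor (g : ℤ → ℝ) {c : ℝ} (hc : 0 ≤ c) :
    CadlagReal (fun x => g ⌊c * x⌋) := by
  intro x
  rcases hc.eq_or_lt with rfl | hc
  · simp only [zero_mul]
    exact ⟨continuousWithinAt_const, _, tendsto_const_nhds⟩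
  · have hcont : Tendsto (fun y : ℝ => c * y) (𝓝 x) (𝓝 (c * x)) :=
      (continuous_const.mul continuous_id).tendsto x
    constructor
    · have h1 : Tendsto (fun y : ℝ => c * y) (𝓝[≥] x) (𝓝[≥] (c * x)) :=
        tendsto_nhdsWithin_of_tendsto_nhds_of_eventually_within _
          (hcont.mono_left nhdsWithin_le_nhds)
          (eventually_nhdsWithin_of_forall fun y hy => mul_le_mul_of_nonneg_left hy hc.le)
      have h2 := (tendsto_floor_right_pure_floor (c * x)).comp h1
      exact ((tendsto_pure_pure g _).comp h2).mono_right (pure_le_nhds _)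
    · have h1 : Tendsto (fun y : ℝ => c * y) (𝓝[<] x) (𝓝[<] (c * x)) :=
        tendsto_nhdsWithin_of_tendsto_nhds_of_eventually_within _
          (hcont.mono_left nhdsWithin_le_nhds)
          (eventually_nhdsWithin_of_forall fun y hy => mul_lt_mul_of_pos_left hy hc)
      have h2 := (tendsto_floor_left_pure_ceil_sub_one (c * x)).comp h1
      exact ⟨_, ((tendsto_pure_pure g _).comp h2).mono_right (pure_le_nhds _)⟩

/-- The normalized local time process `t_n` as a `D(ℝ)`-valued map. -/
noncomputable def localTimePath (X : ℕ → Ω → S) (n : ℕ) (ω : Ω) : SkorokhodD where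
  toFun := localTime X n ω
  cadlag := cadlag_comp_floor (fun j => (visitCount X n j ω : ℝ) / √(n : ℝ)) (Real.sqrt_nonneg _)

end LocalTime

/-! Tightness follows from a modulus of continuity of the local time down to the lattice scale
`1/√n`. This modulus comes from dyadic chaining and the tail bound P(|L_n(x) - L_n(y)| ≥ l) ≤ C
(x-y)² n / l⁴, which is what a fourth moment bound on the natural scale (|x-y|√n)^(1/2) would give
(`IsMarkovChain.exists_real_visitCount_sub_le`).

The tail bound rests on elementary potential theory of the walk (X_k, S_k) on S × ℤ, with transition
operator T; no local limit theorem is needed. Strong aperiodicity and zero mean make this walk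
irreducible (`StronglyAperiodic.reaches`). Poisson's equation supplies ψ for which z + ψ(i) is a
martingale with bounded increments. The distance of this coordinate to a fixed value is subharmonic,
is harmonic far from that value, grows in mean by at most κ√N in N steps, and gains at least δ in r
steps when started at the value. Telescoping these facts bounds the Green function up to time N by
O(√N). A difference of two distances, corrected near the origin by a bounded superharmonic function,
is a supersolution; the maximum principle then makes the Green function Lipschitz in its starting
point, uniformly in N (`HarmonicCorrector.exists_greenOp_pointInd_le_add`).

Let v be the difference of the indicators of levels x and y. Its Green potential is O(|x-y|), while
that of |v| is only O(√n). A concave majorant (`expMajorant`) lets the potential of v enter E exp(θ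
∑ v) to first order and that of |v| only with a further small factor, so θ of order (|x-y|√n)^(-1/2)
is admissible (`iterate_weightedOp_exp_le`). Since e^t ≥ t⁴/4!, the fourth order tail follows.

For compactness, t_n is a step function on a lattice of mesh `1/√n` with a uniform modulus at all
coarser scales. An ultrafilter on such functions either concentrates on one lattice or has a
continuous limit; in both cases convergence is locally uniform, and hence holds in J₁ with the
identity as time change. -/

/-! ### The transition operator of the Markov additive walk -/

/-- The transition operator of the walk `(X_k, S_k)` on `S × ℤ`. -/
noncomputable def walkOp {S : Finset ℤ} (P : Matrix S S ℝ) : Module.End ℝ (S → ℤ → ℝ) where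
  toFun f i z := ∑ j, P i j * f j (z + j)
  map_add' f g := by
    ext i z
    simp [mul_add, Finset.sum_add_distrib]
  map_smul' c f := by
    ext i z
    simp only [Pi.smul_apply, smul_eq_mul, RingHom.id_apply, Finset.mul_sum]
    exact Finset.sum_congr rfl fun j _ => by ring

/-- The indicator function of the point `(j, x)` of `S × ℤ`. -/
noncomputable def pointInd {S : Finset ℤ} (j : S) (x : ℤ) : S → ℤ → ℝ :=
  fun i z => if i = j ∧ z = x then 1 else 0

/-- The indicator function of the level `S × {x}`. -/
noncomputable def levelInd (S : Finset ℤ) (x : ℤ) : S → ℤ → ℝ :=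
  fun _ z => if z = x then 1 else 0

section WalkOp

variable {S : Finset ℤ} {P : Matrix S S ℝ}

theorem walkOp_apply (f : S → ℤ → ℝ) (i : S) (z : ℤ) :
    walkOp P f i z = ∑ j, P i j * f j (z + j) := rfl

theorem walkOp_pow_succ_apply (k : ℕ) (f : S → ℤ → ℝ) :
    (walkOp P ^ (k + 1)) f = walkOp P ((walkOp P ^ k) f) := by
  rw [pow_succ', Module.End.mul_apply]

theorem walkOp_mono (hP : P ∈ Matrix.rowStochastic ℝ S) {f g : S → ℤ → ℝ} (h : f ≤ g) :
    walkOp P f ≤ walkOp P g := fun _ _ =>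
  Finset.sum_le_sum fun j _ => mul_le_mul_of_nonneg_left (h j _)
    (Matrix.nonneg_of_mem_rowStochastic hP)

theorem walkOp_pow_mono (hP : P ∈ Matrix.rowStochastic ℝ S) (k : ℕ) {f g : S → ℤ → ℝ}
    (h : f ≤ g) : (walkOp P ^ k) f ≤ (walkOp P ^ k) g := by
  induction k with
  | zero => simpa using h
  | succ k ih =>
    rw [walkOp_pow_succ_apply, walkOp_pow_succ_apply]
    exact walkOp_mono hP ih

theorem walkOp_pow_nonneg (hP : P ∈ Matrix.rowStochastic ℝ S) (k : ℕ) {f : S → ℤ → ℝ}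
    (h : 0 ≤ f) : 0 ≤ (walkOp P ^ k) f := by
  simpa using walkOp_pow_mono hP k h

theorem walkOp_const (hP : P ∈ Matrix.rowStochastic ℝ S) (c : ℝ) :
    walkOp P (fun _ _ => c) = fun _ _ => c := by
  ext i z
  rw [walkOp_apply, ← Finset.sum_mul, Matrix.sum_row_of_mem_rowStochastic hP, one_mul]

theorem walkOp_pow_const (hP : P ∈ Matrix.rowStochastic ℝ S) (k : ℕ) (c : ℝ) :
    (walkOp P ^ k) (fun _ _ => c) = fun _ _ => c := by
  induction k with
  | zero => simp
  | succ k ih => rw [walkOp_pow_succ_apply, ih, walkOp_const hP]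

theorem walkOp_pow_translate (k : ℕ) (f : S → ℤ → ℝ) (c : ℤ) (i : S) (z : ℤ) :
    (walkOp P ^ k) (fun i z => f i (z + c)) i z = (walkOp P ^ k) f i (z + c) := by
  induction k generalizing i z with
  | zero => simp
  | succ k ih =>
    rw [walkOp_pow_succ_apply, walkOp_pow_succ_apply, walkOp_apply, walkOp_apply]
    exact Finset.sum_congr rfl fun j _ => by rw [ih, add_right_comm]

theorem pointInd_nonneg (j : S) (x : ℤ) : 0 ≤ pointInd j x := fun i z => by
  simp only [pointInd, Pi.zero_apply]; split_ifs <;> norm_num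

theorem pointInd_le_one (j : S) (x : ℤ) (i : S) (z : ℤ) : pointInd j x i z ≤ 1 := by
  simp only [pointInd]; split_ifs <;> norm_num

theorem pointInd_self (j : S) (x : ℤ) : pointInd j x j x = 1 := by simp [pointInd]

theorem pointInd_of_ne {j i : S} {x z : ℤ} (h : ¬ (i = j ∧ z = x)) : pointInd j x i z = 0 := by
  simp [pointInd, h]

theorem walkOp_pow_pointInd_nonneg (hP : P ∈ Matrix.rowStochastic ℝ S) (k : ℕ) (j : S) (x : ℤ) :
    0 ≤ (walkOp P ^ k) (pointInd j x) := walkOp_pow_nonneg hP k (pointInd_nonneg j x)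

theorem walkOp_pow_pointInd_le_one (hP : P ∈ Matrix.rowStochastic ℝ S) (k : ℕ) (j : S) (x : ℤ)
    (i : S) (z : ℤ) : (walkOp P ^ k) (pointInd j x) i z ≤ 1 := by
  have h := walkOp_pow_mono hP k (f := pointInd j x) (g := fun _ _ => 1) (pointInd_le_one j x)
  rw [walkOp_pow_const hP] at h
  exact h i z

theorem walkOp_pow_pointInd_translate (k : ℕ) (j : S) (x c : ℤ) (i : S) (z : ℤ) :
    (walkOp P ^ k) (pointInd j (x + c)) i (z + c) = (walkOp P ^ k) (pointInd j x) i z := by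
  rw [← walkOp_pow_translate]
  refine congrFun (congrFun (congrArg _ ?_) i) z
  ext i z
  simp [pointInd]

theorem levelInd_eq_sum (x : ℤ) : levelInd S x = ∑ j, pointInd j x := by
  ext i z
  simp [levelInd, pointInd, Finset.sum_apply, ite_and]

theorem levelInd_nonneg (x : ℤ) : 0 ≤ levelInd S x := fun i z => by
  simp only [levelInd, Pi.zero_apply]; split_ifs <;> norm_num

end WalkOp

/-! ### Irreducibility of the walk -/

/-- `Reaches P i z j`: there is a path of positive probability from `i` to `j` along which the
walk moves by `z`. -/
inductive Reaches {S : Finset ℤ} (P : Matrix S S ℝ) (i : S) : ℤ → S → Prop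
  | refl : Reaches P i 0 i
  | step {z : ℤ} {j k : S} : Reaches P i z j → 0 < P j k → Reaches P i (z + k) k

section Reaches

variable {S : Finset ℤ} {P : Matrix S S ℝ}

theorem Reaches.trans {i j k : S} {y z : ℤ} (h : Reaches P i y j) (h' : Reaches P j z k) :
    Reaches P i (y + z) k := by
  induction h' with
  | refl => simpa using h
  | step _ hp ih => rw [← add_assoc]; exact ih.step hp

/-- The value of T^k applied to the indicator of (j, z) at (i, 0) is the probability of being at (j,
z) after k steps. A new last edge is absorbed by comparing T applied to the new indicator with a
multiple of the old one. -/
theorem Reaches.exists_pow_pos (hP : P ∈ Matrix.rowStochastic ℝ S) {i j : S} {z : ℤ}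
    (h : Reaches P i z j) : ∃ k, 0 < (walkOp P ^ k) (pointInd j z) i 0 := by
  induction h with
  | refl => exact ⟨0, by simp [pointInd]⟩
  | @step z j k _ hp ih =>
    obtain ⟨n, hn⟩ := ih
    refine ⟨n + 1, (mul_pos hp hn).trans_le ?_⟩
    have hle : P j k • pointInd j z ≤ walkOp P (pointInd k (z + k)) := by
      intro a w
      simp only [Pi.smul_apply, smul_eq_mul]
      by_cases haw : a = j ∧ w = z
      · obtain ⟨rfl, rfl⟩ := haw
        rw [pointInd_self, mul_one, walkOp_apply]
        have := Finset.single_le_sum (f := fun l : S => P a l * pointInd k (w + k) l (w + l))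
          (fun l _ => mul_nonneg (Matrix.nonneg_of_mem_rowStochastic hP)
            (pointInd_nonneg _ _ _ _)) (Finset.mem_univ k)
        simpa [pointInd_self] using this
      · rw [pointInd_of_ne haw, mul_zero]
        have := walkOp_pow_pointInd_nonneg hP 1 k (z + k) a w
        simpa using this
    have := walkOp_pow_mono hP n hle
    rw [pow_succ, Module.End.mul_apply]
    simpa using this i 0

theorem exists_reaches (hirr : P.IsIrreducible) (i j : S) : ∃ z, Reaches P i z j := by
  let := P.toQuiver
  obtain ⟨p, -⟩ := hirr.connected i j
  induction p with
  | nil => exact ⟨0, .refl⟩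
  | cons _ e ih =>
    obtain ⟨z, hz⟩ := ih
    exact ⟨_, hz.step e.down⟩

/-- If all loops at `s` have displacements of the same sign, then they all have
displacement `0`. -/
theorem Reaches.eq_zero_of_forall_nonneg (hP : P ∈ Matrix.rowStochastic ℝ S)
    (hirr : P.IsIrreducible) {ν : S → ℝ} (hν : ∀ s, 0 < ν s) (hνP : Matrix.vecMul ν P = ν)
    (hmean : ∑ s : S, ν s * ((s : ℤ) : ℝ) = 0) {s : S} {ε : ℤ} (hε : ε * ε = 1)
    (hs : ∀ z, Reaches P s z s → 0 ≤ ε * z) {z : ℤ} (hz : Reaches P s z s) : z = 0 := by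
  have hεε : ∀ z, ε * (ε * z) = z := fun z => by rw [← mul_assoc, hε, one_mul]
  have hbdd : ∀ i, BddBelow {z | Reaches P s (ε * z) i} := fun i => by
    obtain ⟨c, hc⟩ := exists_reaches hirr i s
    exact ⟨-(ε * c), fun z hz => by
      have := hs _ (Reaches.trans hz hc)
      rw [mul_add, hεε] at this
      linarith⟩
  have hne : ∀ i, {z | Reaches P s (ε * z) i}.Nonempty := fun i => by
    obtain ⟨c, hc⟩ := exists_reaches hirr s i
    exact ⟨ε * c, by rwa [Set.mem_ofPred_eq, hεε]⟩
  -- The least signed displacement of a path from s to i; it exists because closing the path by a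
  -- fixed return gives a loop at s, whose signed displacement is nonnegative. Each edge satisfies h
  -- j ≤ h i + ε j, and the slack has total ν-mean zero by stationarity and zero drift. Hence there
  -- is equality on every edge, and displacements are differences of h.
  set h : S → ℤ := fun i => sInf {z | Reaches P s (ε * z) i}
  have hmem : ∀ i, Reaches P s (ε * h i) i := fun i => Int.csInf_mem (hne i) (hbdd i)
  have hle : ∀ i j, 0 < P i j → h j ≤ h i + ε * j := fun i j hij =>
    csInf_le (hbdd j) (by
      rw [Set.mem_ofPred_eq, mul_add, hεε]
      exact (hmem i).step hij)
  have hnn : ∀ i j, 0 ≤ ν i * (P i j * ((h i : ℝ) + ε * j - h j)) := fun i j => by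
    rcases (Matrix.nonneg_of_mem_rowStochastic hP : 0 ≤ P i j).eq_or_lt with h0 | h0
    · simp [← h0]
    · have : ((h j : ℤ) : ℝ) ≤ h i + ε * j := by exact_mod_cast hle i j h0
      exact mul_nonneg (hν i).le (mul_nonneg h0.le (by linarith))
  have hcol : ∀ j, ∑ i, ν i * P i j = ν j := fun j => by
    have := congrFun hνP j
    simpa [Matrix.vecMul, dotProduct] using this
  have hsum : ∑ i, ∑ j, ν i * (P i j * ((h i : ℝ) + ε * j - h j)) = 0 := by
    have e1 : ∑ i, ∑ j, ν i * (P i j * ((h i : ℝ) + ε * j - h j))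
        = ∑ i, (ν i * h i) * ∑ j, P i j
          + ∑ j : S, (∑ i, ν i * P i j) * (ε * ((j : ℤ) : ℝ) - h j) := by
      simp only [Finset.sum_mul, Finset.mul_sum]
      rw [Finset.sum_comm (s := Finset.univ) (t := Finset.univ)
        (f := fun (j : S) (i : S) => ν i * P i j * (ε * ((j : ℤ) : ℝ) - h j)),
        ← Finset.sum_add_distrib]
      refine Finset.sum_congr rfl fun i _ => ?_
      rw [← Finset.sum_add_distrib]
      exact Finset.sum_congr rfl fun j _ => by ring
    have e2 : ∑ j : S, ν j * ((ε : ℝ) * ((j : ℤ) : ℝ)) = 0 := by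
      simp only [mul_left_comm (ν _)]
      rw [← Finset.mul_sum, hmean, mul_zero]
    rw [e1]
    simp only [hcol, Matrix.sum_row_of_mem_rowStochastic hP, mul_one, mul_sub,
      Finset.sum_sub_distrib, e2]
    ring
  have hz0 : ∀ i j, 0 < P i j → h j = h i + ε * j := fun i j hij => by
    have h1 := (Finset.sum_eq_zero_iff_of_nonneg
      (fun i _ => Finset.sum_nonneg fun j _ => hnn i j)).1 hsum i (Finset.mem_univ i)
    have h2 := (Finset.sum_eq_zero_iff_of_nonneg (fun j _ => hnn i j)).1 h1 j (Finset.mem_univ j)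
    have h3 : (h i : ℝ) + ε * j - h j = 0 := by
      rcases mul_eq_zero.1 h2 with h | h
      · exact absurd h (hν i).ne'
      · exact (mul_eq_zero.1 h).resolve_left hij.ne'
    have h4 : ((h j : ℤ) : ℝ) = ((h i + ε * j : ℤ) : ℝ) := by push_cast; linarith
    exact_mod_cast h4
  have hpath : ∀ {z i}, Reaches P s z i → h i = h s + ε * z := fun {z i} hr => by
    induction hr with
    | refl => simp
    | step _ hp ih => rw [hz0 _ _ hp, ih]; ring
  have h0 : ε * z = 0 := by linarith [hpath hz]
  rw [← hεε z, h0, mul_zero]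

/-- Strong aperiodicity excludes that all loop displacements are multiples of `e ≥ 2`. -/
theorem StronglyAperiodic.exists_reaches_not_dvd (hap : StronglyAperiodic S P)
    (hirr : P.IsIrreducible) (s : S) {e : ℤ} (he : 2 ≤ e) : ∃ z, Reaches P s z s ∧ ¬ e ∣ z := by
  by_contra! hdvd
  choose h hh using fun i => exists_reaches hirr s i
  have hcong : ∀ i j, 0 < P i j → e ∣ h i + j - h j := fun i j hij => by
    obtain ⟨c, hc⟩ := exists_reaches hirr j s
    have h1 := hdvd _ (((hh i).step hij).trans hc)
    have h2 := hdvd _ ((hh j).trans hc)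
    have := dvd_sub h1 h2
    ring_nf at this ⊢
    exact this
  have he0 : (e : ℝ) ≠ 0 := by
    have : (2 : ℝ) ≤ e := by exact_mod_cast he
    positivity
  -- The congruence h j ≡ h i + j mod e turns φ = exp(-2πi h / e) into a solution with t = 2π/e, so
  -- aperiodicity would make 1/e an integer.
  obtain ⟨⟨k, hk⟩, -⟩ := hap (2 * Real.pi / e) 1
    (fun i => Complex.exp (((-(2 * Real.pi / e) * h i : ℝ) : ℂ) * Complex.I)) (by simp)
    (fun i => Complex.norm_exp_ofReal_mul_I _) (fun i j hij => by
      obtain ⟨m, hm⟩ := hcong i j hij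
      rw [← Complex.exp_sub, one_mul, Complex.exp_eq_exp_iff_exists_int]
      refine ⟨m, ?_⟩
      have hj : (((j : ℤ) : ℝ) : ℂ) = (e : ℂ) * m + h j - h i := by
        have : (j : ℤ) = e * m + h j - h i := by linarith
        rw [this]; push_cast; ring
      have he0' : (e : ℂ) ≠ 0 := by exact_mod_cast he0
      rw [hj]
      push_cast
      field_simp
      ring)
  have hpi := Real.pi_pos
  have h1 : (1 : ℝ) = e * k := by
    field_simp at hk
    nlinarith [hk]
  have h2 : (1 : ℤ) = e * k := by exact_mod_cast h1
  have := Int.eq_one_or_neg_one_of_mul_eq_one h2.symm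
  omega

/-- Under strong aperiodicity and zero mean, the walk on `S × ℤ` is irreducible. -/
theorem StronglyAperiodic.reaches (hap : StronglyAperiodic S P)
    (hP : P ∈ Matrix.rowStochastic ℝ S) (hirr : P.IsIrreducible) {ν : S → ℝ}
    (hν : ∀ s, 0 < ν s) (hνP : Matrix.vecMul ν P = ν)
    (hmean : ∑ s : S, ν s * ((s : ℤ) : ℝ) = 0) (i j : S) (z : ℤ) : Reaches P i z j := by
  have hnsmul : ∀ {z : ℤ} (n : ℕ), Reaches P i z i → Reaches P i (n * z) i := fun {z} n hz => by
    induction n with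
    | zero => simpa using Reaches.refl
    | succ n ih =>
      have := ih.trans hz
      push_cast
      rwa [add_mul, one_mul]
  -- With e = 2 this only serves to produce a loop of nonzero displacement.
  obtain ⟨z₀, hz₀, hz₀'⟩ := hap.exists_reaches_not_dvd hirr i le_rfl
  obtain ⟨b, hb, hb0⟩ : ∃ b, Reaches P i b i ∧ b < 0 := by
    by_contra! hcon
    have := Reaches.eq_zero_of_forall_nonneg hP hirr hν hνP hmean (ε := 1) rfl
      (by simpa using hcon) hz₀
    simp [this] at hz₀'
  obtain ⟨a, ha, ha0⟩ : ∃ a, Reaches P i a i ∧ 0 < a := by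
    by_contra! hcon
    have := Reaches.eq_zero_of_forall_nonneg hP hirr hν hνP hmean (ε := -1) rfl
      (by simpa using hcon) hz₀
    simp [this] at hz₀'
  -- Loop displacements form a submonoid of ℤ with elements of both signs, hence a group: for z < 0,
  -- running the loop a > 0 exactly -z times and the loop z exactly a - 1 times gives -z in total.
  have hneg : ∀ {z : ℤ}, Reaches P i z i → Reaches P i (-z) i := fun {z} hz => by
    rcases lt_trichotomy z 0 with h | rfl | h
    · have h1 := (hnsmul (-z).toNat ha).trans (hnsmul (a - 1).toNat hz)
      have e : (((-z).toNat : ℕ) : ℤ) * a + (((a - 1).toNat : ℕ) : ℤ) * z = -z := by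
        rw [Int.toNat_of_nonneg (by omega), Int.toNat_of_nonneg (by omega)]; ring
      rwa [e] at h1
    · simpa using hz
    · have h1 := (hnsmul z.toNat hb).trans (hnsmul (-b - 1).toNat hz)
      have e : ((z.toNat : ℕ) : ℤ) * b + (((-b - 1).toNat : ℕ) : ℤ) * z = -z := by
        rw [Int.toNat_of_nonneg (by omega), Int.toNat_of_nonneg (by omega)]; ring
      rwa [e] at h1
  let D : AddSubgroup ℤ :=
    { carrier := {z | Reaches P i z i}
      add_mem' := fun h h' => Reaches.trans h h'
      zero_mem' := Reaches.refl
      neg_mem' := fun h => hneg h }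
  obtain ⟨d, hd⟩ := Int.subgroup_cyclic D
  have hmemD : ∀ w, Reaches P i w i ↔ d ∣ w := fun w => by
    have : w ∈ D ↔ w ∈ AddSubgroup.closure {d} := by rw [hd]
    rw [AddSubgroup.mem_closure_singleton] at this
    refine (show Reaches P i w i ↔ w ∈ D from Iff.rfl).trans (this.trans ?_)
    simp only [smul_eq_mul, dvd_iff_exists_eq_mul_left, eq_comm]
  have hunit : d.natAbs = 1 := by
    by_contra hne
    rcases Nat.lt_or_gt_of_ne hne with h | h
    · have : d = 0 := by omega
      rw [hmemD, this] at ha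
      have := zero_dvd_iff.1 ha
      omega
    · obtain ⟨w, hw, hw'⟩ := hap.exists_reaches_not_dvd hirr i (e := |d|)
        (by rw [Int.abs_eq_natAbs]; omega)
      exact hw' ((abs_dvd _ _).2 ((hmemD w).1 hw))
  obtain ⟨c, hc⟩ := exists_reaches hirr i j
  have hloop : Reaches P i (z - c) i := (hmemD _).2 (by
    rw [← Int.natAbs_dvd, hunit]; simp)
  simpa using hloop.trans hc

end Reaches

/-! ### The harmonic coordinate -/

section HarmonicCoordinate

variable {S : Finset ℤ} {P : Matrix S S ℝ}

/-- An irreducible stochastic matrix has a positive stationary distribution. -/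
theorem stationary_pos (hP : P ∈ Matrix.rowStochastic ℝ S) (hirr : P.IsIrreducible) {ν : S → ℝ}
    (hν : ν ∈ stdSimplex ℝ S) (hνP : Matrix.vecMul ν P = ν) (s : S) : 0 < ν s := by
  obtain ⟨i, hi⟩ : ∃ i, 0 < ν i := by
    by_contra! hcon
    have : ∑ i, ν i ≤ 0 := Finset.sum_nonpos fun i _ => hcon i
    rw [hν.2] at this
    linarith
  obtain ⟨z, hz⟩ := exists_reaches hirr i s
  induction hz with
  | refl => exact hi
  | @step z j k _ hp ih =>
    have h1 : ∑ l, ν l * P l k = ν k := by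
      have := congrFun hνP k
      simpa [Matrix.vecMul, dotProduct] using this
    rw [← h1]
    exact (mul_pos ih hp).trans_le (Finset.single_le_sum (f := fun l => ν l * P l k)
      (fun l _ => mul_nonneg (hν.1 l) (Matrix.nonneg_of_mem_rowStochastic hP))
      (Finset.mem_univ j))

/-- Harmonic functions of an irreducible stochastic matrix are constant. -/
theorem eq_of_mulVec_eq_self (hP : P ∈ Matrix.rowStochastic ℝ S) (hirr : P.IsIrreducible)
    {f : S → ℝ} (hf : P.mulVec f = f) (i j : S) : f i = f j := by
  have : Nonempty S := ⟨i⟩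
  obtain ⟨a, ha⟩ := Finite.exists_max f
  have key : ∀ b, f b = f a := fun b => by
    obtain ⟨z, hz⟩ := exists_reaches hirr a b
    induction hz with
    | refl => rfl
    | @step z j k _ hp ih =>
      have h1 : ∑ l, P j l * (f a - f l) = 0 := by
        have h2 : ∑ l, P j l * f l = f j := by
          have := congrFun hf j
          simpa [Matrix.mulVec, dotProduct] using this
        simp only [mul_sub, Finset.sum_sub_distrib, h2, ← Finset.sum_mul,
          Matrix.sum_row_of_mem_rowStochastic hP, ih]
        ring
      have h3 := (Finset.sum_eq_zero_iff_of_nonneg (fun l _ => mul_nonneg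
        (Matrix.nonneg_of_mem_rowStochastic hP) (sub_nonneg.2 (ha l)))).1 h1 k (Finset.mem_univ k)
      have := (mul_eq_zero.1 h3).resolve_left hp.ne'
      linarith
  rw [key i, key j]

/-- Poisson's equation for an irreducible stochastic matrix: a function with zero stationary mean
is of the form `ψ - P ψ`. -/
theorem exists_sub_mulVec_eq (hP : P ∈ Matrix.rowStochastic ℝ S) (hirr : P.IsIrreducible)
    {ν : S → ℝ} (hν : ν ∈ stdSimplex ℝ S) (hνP : Matrix.vecMul ν P = ν) {b : S → ℝ}
    (hb : ∑ s, ν s * b s = 0) : ∃ ψ : S → ℝ, ∀ i, ψ i - ∑ j, P i j * ψ j = b i := by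
  set A : (S → ℝ) →ₗ[ℝ] (S → ℝ) := LinearMap.id - P.mulVecLin with hA
  set L : (S → ℝ) →ₗ[ℝ] ℝ := Fintype.linearCombination ℝ ν with hL
  have hAapp : ∀ f i, A f i = f i - ∑ j, P i j * f j := fun f i => by
    simp [hA, Matrix.mulVec, dotProduct]
  have hLapp : ∀ f, L f = ∑ s, ν s * f s := fun f => by
    simp [hL, Fintype.linearCombination_apply, mul_comm]
  have hle : LinearMap.range A ≤ LinearMap.ker L := by
    rintro _ ⟨f, rfl⟩
    rw [LinearMap.mem_ker, hLapp]
    simp only [hAapp, mul_sub, Finset.sum_sub_distrib, Finset.mul_sum]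
    rw [Finset.sum_comm, sub_eq_zero]
    refine Finset.sum_congr rfl fun j _ => ?_
    have := congrFun hνP j
    simp only [Matrix.vecMul, dotProduct] at this
    simp only [← mul_assoc, ← Finset.sum_mul]
    rw [this]
  have hker : Module.finrank ℝ (LinearMap.ker A) ≤ 1 := by
    refine finrank_le_one (⟨fun _ => 1, ?_⟩ : LinearMap.ker A) ?_
    · rw [LinearMap.mem_ker]
      ext i
      rw [hAapp]
      simp only [mul_one, Matrix.sum_row_of_mem_rowStochastic hP, sub_self, Pi.zero_apply]
    · rintro ⟨f, hf⟩
      rw [LinearMap.mem_ker] at hf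
      have hPf : P.mulVec f = f := by
        have : f - P.mulVec f = 0 := hf
        exact (sub_eq_zero.1 this).symm
      rcases isEmpty_or_nonempty S with h | ⟨⟨s⟩⟩
      · exact ⟨0, Subtype.ext (funext fun i => h.elim i)⟩
      · exact ⟨f s, Subtype.ext (funext fun i => by
          simpa using eq_of_mulVec_eq_self hP hirr hPf s i)⟩
  have hrankA := LinearMap.finrank_range_add_finrank_ker A
  have hrankL := LinearMap.finrank_range_add_finrank_ker L
  have hrL : Module.finrank ℝ (LinearMap.range L) = 1 := by
    have : LinearMap.range L = ⊤ := by
      rw [LinearMap.range_eq_top]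
      refine LinearMap.surjective fun h0 => ?_
      have := LinearMap.congr_fun h0 (fun _ => 1)
      rw [hLapp] at this
      simp only [mul_one, hν.2, LinearMap.zero_apply, one_ne_zero] at this
    rw [this, finrank_top, Module.finrank_self]
  -- The range of I - P lies in the hyperplane annihilated by ν, and its codimension is at most one
  -- because the kernel consists of constants.
  have heq := Submodule.eq_of_le_of_finrank_le hle (by omega)
  have hbmem : b ∈ LinearMap.range A := by rw [heq, LinearMap.mem_ker, hLapp, hb]
  obtain ⟨ψ, hψ⟩ := hbmem
  exact ⟨ψ, fun i => by rw [← hAapp, hψ]⟩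

/-- The structure used in the potential theory of the walk: a function `ψ` such that `z + ψ i` is
harmonic for the walk and has increments of size at most `κ`. -/
structure HarmonicCorrector (P : Matrix S S ℝ) where
  /-- the corrector -/
  ψ : S → ℝ
  /-- the bound for the increments -/
  κ : ℝ
  κ_pos : 0 < κ
  harmonic : ∀ i : S, ∑ j : S, P i j * (((j : ℤ) : ℝ) + ψ j) = ψ i
  incr_le : ∀ i j : S, |((j : ℤ) : ℝ) + ψ j - ψ i| ≤ κ

/-- The mean next step, as a function of the current state, has zero stationary mean because νP = ν,
so Poisson's equation can be solved for it. The bound κ is crude; the summand 1 keeps it positive.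
-/
theorem nonempty_harmonicCorrector (hP : P ∈ Matrix.rowStochastic ℝ S) (hirr : P.IsIrreducible)
    {ν : S → ℝ} (hν : ν ∈ stdSimplex ℝ S) (hνP : Matrix.vecMul ν P = ν)
    (hmean : ∑ s : S, ν s * ((s : ℤ) : ℝ) = 0) : Nonempty (HarmonicCorrector P) := by
  obtain ⟨ψ, hψ⟩ := exists_sub_mulVec_eq hP hirr hν hνP
    (b := fun i => ∑ j, P i j * ((j : ℤ) : ℝ)) (by
      simp only [Finset.mul_sum, ← mul_assoc]
      rw [Finset.sum_comm]
      simp only [← Finset.sum_mul]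
      have hcol : ∀ j, ∑ i, ν i * P i j = ν j := fun j => by
        have := congrFun hνP j
        simpa [Matrix.vecMul, dotProduct] using this
      simpa only [hcol] using hmean)
  refine ⟨⟨ψ, 1 + ∑ i : S, ∑ j : S, |((j : ℤ) : ℝ) + ψ j - ψ i|, by positivity, fun i => ?_,
    fun i j => ?_⟩⟩
  · have := hψ i
    simp only [mul_add, Finset.sum_add_distrib]
    linarith
  · have h1 := Finset.single_le_sum (f := fun j : S => |((j : ℤ) : ℝ) + ψ j - ψ i|)
      (fun _ _ => abs_nonneg _) (Finset.mem_univ j)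
    have h2 := Finset.single_le_sum (f := fun i : S => ∑ j : S, |((j : ℤ) : ℝ) + ψ j - ψ i|)
      (fun _ _ => Finset.sum_nonneg fun _ _ => abs_nonneg _) (Finset.mem_univ i)
    linarith

namespace HarmonicCorrector

/-- The harmonic coordinate `z + ψ i`. -/
def coord (h : HarmonicCorrector P) (i : S) (z : ℤ) : ℝ := z + h.ψ i

/-- The distance of the harmonic coordinate to `c`. -/
def dist (h : HarmonicCorrector P) (c : ℝ) : S → ℤ → ℝ := fun i z => |h.coord i z - c|

variable (h : HarmonicCorrector P)

theorem abs_coord_sub_le (i j : S) (z : ℤ) : |h.coord j (z + j) - h.coord i z| ≤ h.κ := by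
  have := h.incr_le i j
  simp only [coord]
  push_cast
  rwa [show ((z : ℝ) + (j : ℤ) + h.ψ j - (z + h.ψ i)) = ((j : ℤ) : ℝ) + h.ψ j - h.ψ i by ring]

theorem walkOp_coord (hP : P ∈ Matrix.rowStochastic ℝ S) : walkOp P h.coord = h.coord := by
  ext i z
  rw [walkOp_apply]
  have h1 := h.harmonic i
  simp only [coord]
  have h2 : ∀ j : S, P i j * (((z + j : ℤ) : ℝ) + h.ψ j)
      = P i j * z + P i j * (((j : ℤ) : ℝ) + h.ψ j) := fun j => by push_cast; ring
  simp only [h2, Finset.sum_add_distrib, h1, ← Finset.sum_mul,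
    Matrix.sum_row_of_mem_rowStochastic hP, one_mul]

theorem walkOp_coord_sub (hP : P ∈ Matrix.rowStochastic ℝ S) (c : ℝ) :
    walkOp P (fun i z => h.coord i z - c) = fun i z => h.coord i z - c := by
  have : (fun i z => h.coord i z - c) = h.coord - fun (_ : S) (_ : ℤ) => c := rfl
  rw [this, map_sub, h.walkOp_coord hP, walkOp_const hP]

theorem dist_le_walkOp_dist (hP : P ∈ Matrix.rowStochastic ℝ S) (c : ℝ) :
    h.dist c ≤ walkOp P (h.dist c) := by
  have h1 := walkOp_mono hP (f := fun i z => h.coord i z - c) (g := h.dist c)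
    (fun i z => le_abs_self _)
  have h2 := walkOp_mono hP (f := -fun i z => h.coord i z - c) (g := h.dist c)
    (fun i z => neg_le_abs _)
  rw [map_neg] at h2
  rw [h.walkOp_coord_sub hP] at h1 h2
  exact fun i z => abs_le'.2 ⟨h1 i z, h2 i z⟩

theorem monotone_walkOp_pow_dist (hP : P ∈ Matrix.rowStochastic ℝ S) (c : ℝ) :
    Monotone fun k => (walkOp P ^ k) (h.dist c) :=
  monotone_nat_of_le_succ fun k => by
    rw [pow_succ, Module.End.mul_apply]
    exact walkOp_pow_mono hP k (h.dist_le_walkOp_dist hP c)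

theorem dist_le_walkOp_pow_dist (hP : P ∈ Matrix.rowStochastic ℝ S) (c : ℝ) (k : ℕ) :
    h.dist c ≤ (walkOp P ^ k) (h.dist c) := by
  simpa using h.monotone_walkOp_pow_dist hP c (Nat.zero_le k)

/-- The increment of the coordinate has conditional mean zero, which kills the cross term, and
modulus at most κ. -/
theorem walkOp_sq_le (hP : P ∈ Matrix.rowStochastic ℝ S) (c : ℝ) (i : S) (z : ℤ) :
    walkOp P (fun i z => (h.coord i z - c) ^ 2) i z ≤ (h.coord i z - c) ^ 2 + h.κ ^ 2 := by
  have h1 := congrFun (congrFun (h.walkOp_coord hP) i) z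
  have hs := Matrix.sum_row_of_mem_rowStochastic hP i
  rw [walkOp_apply] at h1 ⊢
  have h2 : ∀ j : S, P i j * (h.coord j (z + j) - c) ^ 2
      ≤ P i j * ((h.coord i z - c) ^ 2 + h.κ ^ 2 - 2 * (h.coord i z - c) * h.coord i z)
        + 2 * (h.coord i z - c) * (P i j * h.coord j (z + j)) := fun j => by
    have h3 := sq_le_sq' (neg_le_of_abs_le (h.abs_coord_sub_le i j z))
      (le_of_abs_le (h.abs_coord_sub_le i j z))
    have h4 : 0 ≤ P i j := Matrix.nonneg_of_mem_rowStochastic hP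
    nlinarith [mul_le_mul_of_nonneg_left h3 h4]
  refine (Finset.sum_le_sum fun j _ => h2 j).trans (le_of_eq ?_)
  rw [Finset.sum_add_distrib, ← Finset.sum_mul, ← Finset.mul_sum, h1, hs]
  ring

theorem walkOp_pow_sq_le (hP : P ∈ Matrix.rowStochastic ℝ S) (c : ℝ) (k : ℕ) (i : S) (z : ℤ) :
    (walkOp P ^ k) (fun i z => (h.coord i z - c) ^ 2) i z
      ≤ (h.coord i z - c) ^ 2 + k * h.κ ^ 2 := by
  induction k generalizing i z with
  | zero => simp
  | succ k ih =>
    rw [walkOp_pow_succ_apply]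
    refine (walkOp_mono hP (g := (fun i z => (h.coord i z - c) ^ 2) +
      fun _ _ => k * h.κ ^ 2) ih i z).trans ?_
    rw [map_add, walkOp_const hP]
    have := h.walkOp_sq_le hP c i z
    simp only [Pi.add_apply]
    push_cast
    linarith

/-- The mean displacement of the harmonic coordinate in `k` steps is at most `κ √k`. -/
theorem walkOp_pow_dist_le_sqrt (hP : P ∈ Matrix.rowStochastic ℝ S) (c : ℝ) (k : ℕ) (i : S)
    (z : ℤ) : (walkOp P ^ k) (h.dist c) i z ≤ h.dist c i z + h.κ * √k := by
  rcases Nat.eq_zero_or_pos k with rfl | hk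
  · simp
  have hs : 0 < h.κ * √k := mul_pos h.κ_pos (Real.sqrt_pos.2 (by exact_mod_cast hk))
  set s := h.κ * √k with hsdef
  have hs2 : s ^ 2 = k * h.κ ^ 2 := by
    rw [hsdef, mul_pow, Real.sq_sqrt (Nat.cast_nonneg k)]; ring
  set m := h.coord i z
  -- Cauchy–Schwarz in the linear form |u| ≤ s/2 + u²/(2s); with s = κ√k the second moment s² makes
  -- both terms s/2.
  have hle : h.dist c ≤ (fun _ _ => |m - c| + s / 2) +
      (1 / (2 * s)) • (fun i z => (h.coord i z - m) ^ 2 : S → ℤ → ℝ) := fun a w => by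
    simp only [dist, Pi.add_apply, Pi.smul_apply, smul_eq_mul]
    have h1 : |h.coord a w - c| ≤ |m - c| + |h.coord a w - m| := by
      have := abs_add_le (m - c) (h.coord a w - m)
      rwa [show m - c + (h.coord a w - m) = h.coord a w - c by ring] at this
    have h2 : |h.coord a w - m| ≤ s / 2 + 1 / (2 * s) * (h.coord a w - m) ^ 2 := by
      rw [← sq_abs (h.coord a w - m)]
      have : s / 2 + 1 / (2 * s) * |h.coord a w - m| ^ 2 - |h.coord a w - m|
          = (s - |h.coord a w - m|) ^ 2 / (2 * s) := by field_simp; ring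
      have h3 : 0 ≤ (s - |h.coord a w - m|) ^ 2 / (2 * s) := by positivity
      linarith
    linarith
  have h1 := walkOp_pow_mono hP k hle i z
  rw [map_add, map_smul, walkOp_pow_const hP] at h1
  have h2 := h.walkOp_pow_sq_le hP m k i z
  rw [show h.coord i z - m = 0 from sub_self _, ← hs2] at h2
  simp only [Pi.add_apply, Pi.smul_apply, smul_eq_mul] at h1
  have h3 := mul_le_mul_of_nonneg_left h2 (show 0 ≤ 1 / (2 * s) by positivity)
  have h4 : 1 / (2 * s) * (0 ^ 2 + s ^ 2) = s / 2 := by field_simp; ring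
  simp only [dist]
  linarith

/-- At distance at least κ from c a single step cannot cross c, so the absolute value opens with a
constant sign and the martingale property applies. Closer to c, one step adds at most κ. -/
theorem walkOp_dist_le (hP : P ∈ Matrix.rowStochastic ℝ S) (c : ℝ) (i : S) (z : ℤ) :
    walkOp P (h.dist c) i z ≤ h.dist c i z + if h.dist c i z < h.κ then h.κ else 0 := by
  have hs := Matrix.sum_row_of_mem_rowStochastic hP i
  have hstep := h.abs_coord_sub_le i
  have hpn : ∀ j, 0 ≤ P i j := fun j => Matrix.nonneg_of_mem_rowStochastic hP
  by_cases hlt : h.dist c i z < h.κ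
  · rw [if_pos hlt, walkOp_apply]
    have h2 : ∀ j : S, P i j * h.dist c j (z + j) ≤ P i j * (h.dist c i z + h.κ) := fun j => by
      refine mul_le_mul_of_nonneg_left ?_ (hpn j)
      have := abs_add_le (h.coord i z - c) (h.coord j (z + j) - h.coord i z)
      rw [show h.coord i z - c + (h.coord j (z + j) - h.coord i z) = h.coord j (z + j) - c by
        ring] at this
      simp only [dist]
      linarith [hstep j z]
    refine (Finset.sum_le_sum fun j _ => h2 j).trans (le_of_eq ?_)
    rw [← Finset.sum_mul, hs, one_mul]
  · rw [if_neg hlt, add_zero]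
    simp only [dist, not_lt] at hlt ⊢
    have h1 := congrFun (congrFun (h.walkOp_coord_sub hP c) i) z
    rw [walkOp_apply] at h1 ⊢
    rcases le_total 0 (h.coord i z - c) with h0 | h0
    · rw [abs_of_nonneg h0] at hlt ⊢
      rw [← h1]
      refine Finset.sum_le_sum fun j _ => mul_le_mul_of_nonneg_left ?_ (hpn j)
      rw [HarmonicCorrector.dist, abs_of_nonneg]
      have := neg_le_of_abs_le (hstep j z)
      linarith
    · rw [abs_of_nonpos h0] at hlt ⊢
      rw [← h1, ← Finset.sum_neg_distrib]
      refine Finset.sum_le_sum fun j _ => ?_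
      rw [← mul_neg]
      refine mul_le_mul_of_nonneg_left ?_ (hpn j)
      rw [HarmonicCorrector.dist, abs_of_nonpos]
      have := le_of_abs_le (hstep j z)
      linarith

/-- The distance to `c` is harmonic away from `c`. -/
theorem walkOp_pow_dist_le (hP : P ∈ Matrix.rowStochastic ℝ S) (c : ℝ) (k : ℕ) (i : S) (z : ℤ) :
    (walkOp P ^ k) (h.dist c) i z
      ≤ h.dist c i z + if h.dist c i z < k * h.κ then k * h.κ else 0 := by
  have hκ := h.κ_pos
  induction k generalizing i z with
  | zero => simp
  | succ k ih =>
    rw [walkOp_pow_succ_apply]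
    refine (walkOp_mono hP (g := h.dist c +
      fun i z => if h.dist c i z < k * h.κ then k * h.κ else 0) ih i z).trans ?_
    rw [map_add, Pi.add_apply, Pi.add_apply]
    have h1 := h.walkOp_dist_le hP c i z
    -- The ball of radius kκ is entered in one step only from the ball of radius (k+1)κ.
    have h2 : walkOp P (fun i z => if h.dist c i z < k * h.κ then k * h.κ else 0) i z
        ≤ if h.dist c i z < (k + 1) * h.κ then k * h.κ else 0 := by
      have h3 : ∀ j : S, P i j * (if h.dist c j (z + j) < k * h.κ then k * h.κ else 0)
          ≤ P i j * (if h.dist c i z < (k + 1) * h.κ then k * h.κ else 0) := fun j => by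
        refine mul_le_mul_of_nonneg_left ?_ (Matrix.nonneg_of_mem_rowStochastic hP)
        have h4 : h.dist c i z ≤ h.dist c j (z + j) + h.κ := by
          have h5 := abs_sub_abs_le_abs_sub (h.coord i z - c) (h.coord j (z + j) - c)
          have h6 := h.abs_coord_sub_le i j z
          rw [abs_sub_comm, show h.coord i z - h.coord j (z + j)
            = h.coord i z - c - (h.coord j (z + j) - c) by ring] at h6
          simp only [dist]
          linarith
        have h0 : 0 ≤ k * h.κ := by positivity
        split_ifs <;> linarith
      refine (Finset.sum_le_sum fun j _ => h3 j).trans (le_of_eq ?_)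
      rw [← Finset.sum_mul, Matrix.sum_row_of_mem_rowStochastic hP, one_mul]
    have h0 : 0 ≤ k * h.κ := by positivity
    push_cast
    split_ifs at h1 h2 ⊢ <;> linarith

/-- The harmonic coordinate is non-degenerate, uniformly in the starting point. -/
theorem exists_le_walkOp_pow_dist (hP : P ∈ Matrix.rowStochastic ℝ S)
    (hr : ∀ (i j : S) (z : ℤ), Reaches P i z j) : ∃ (r : ℕ) (δ : ℝ), 0 < δ ∧ ∀ i z,
      δ ≤ (walkOp P ^ r) (h.dist (h.coord i z)) i z := by
  choose k hk using fun i => (hr i i 1).exists_pow_pos hP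
  obtain ⟨δ, hδ, hδk⟩ : ∃ δ : ℝ, 0 < δ ∧ ∀ i, δ ≤ (walkOp P ^ (k i)) (pointInd i 1) i 0 := by
    rcases isEmpty_or_nonempty S with hS | hS
    · exact ⟨1, one_pos, fun i => hS.elim i⟩
    · obtain ⟨i, hi⟩ := Finite.exists_min fun i => (walkOp P ^ (k i)) (pointInd i 1) i 0
      exact ⟨_, hk i, hi⟩
  -- A single r for all states: the mean distance is nondecreasing in time, so any upper bound of
  -- the `k i` works. The target (i, z + 1) is chosen because ψ cancels and the distance there is
  -- exactly 1.
  refine ⟨∑ i, k i, δ, hδ, fun i z => ?_⟩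
  have h1 : pointInd i (z + 1) ≤ h.dist (h.coord i z) := fun a w => by
    by_cases haw : a = i ∧ w = z + 1
    · obtain ⟨rfl, rfl⟩ := haw
      rw [pointInd_self]
      simp [dist, coord]
    · rw [pointInd_of_ne haw]
      exact abs_nonneg _
  have h2 := walkOp_pow_mono hP (k i) h1 i z
  have h3 := walkOp_pow_pointInd_translate (P := P) (k i) i 1 z i 0
  rw [zero_add, add_comm 1 z] at h3
  rw [h3] at h2
  exact (hδk i).trans (h2.trans (h.monotone_walkOp_pow_dist hP _
    (Finset.single_le_sum (fun _ _ => Nat.zero_le _) (Finset.mem_univ i)) i z))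

end HarmonicCorrector

end HarmonicCoordinate

/-! ### Bounds for the Green function -/

section Green

variable {S : Finset ℤ} {P : Matrix S S ℝ}

/-- The Green operator `∑_{k<N} T^k` of the walk. -/
noncomputable def greenOp (P : Matrix S S ℝ) (N : ℕ) : Module.End ℝ (S → ℤ → ℝ) :=
  ∑ k ∈ Finset.range N, walkOp P ^ k

theorem greenOp_apply (N : ℕ) (f : S → ℤ → ℝ) (i : S) (z : ℤ) :
    greenOp P N f i z = ∑ k ∈ Finset.range N, (walkOp P ^ k) f i z := by
  simp [greenOp, Finset.sum_apply]

theorem greenOp_zero (f : S → ℤ → ℝ) : greenOp P 0 f = 0 := by simp [greenOp]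

theorem greenOp_succ (N : ℕ) (f : S → ℤ → ℝ) :
    greenOp P (N + 1) f = f + walkOp P (greenOp P N f) := by
  simp only [greenOp, LinearMap.sum_apply, map_sum, ← walkOp_pow_succ_apply]
  rw [Finset.sum_range_succ', add_comm, pow_zero, Module.End.one_apply]

theorem greenOp_mono (hP : P ∈ Matrix.rowStochastic ℝ S) (N : ℕ) {f g : S → ℤ → ℝ} (h : f ≤ g) :
    greenOp P N f ≤ greenOp P N g := fun i z => by
  rw [greenOp_apply, greenOp_apply]
  exact Finset.sum_le_sum fun k _ => walkOp_pow_mono hP k h i z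

theorem greenOp_nonneg (hP : P ∈ Matrix.rowStochastic ℝ S) (N : ℕ) {f : S → ℤ → ℝ} (h : 0 ≤ f) :
    0 ≤ greenOp P N f := by
  simpa using greenOp_mono hP N h

theorem greenOp_le_succ (hP : P ∈ Matrix.rowStochastic ℝ S) (N : ℕ) {f : S → ℤ → ℝ}
    (h : 0 ≤ f) (i : S) (z : ℤ) : greenOp P N f i z ≤ greenOp P (N + 1) f i z := by
  rw [greenOp_apply, greenOp_apply, Finset.sum_range_succ]
  exact le_add_of_nonneg_right (walkOp_pow_nonneg hP N h i z)

theorem greenOp_pointInd_translate (N : ℕ) (j : S) (x c : ℤ) (i : S) (z : ℤ) :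
    greenOp P N (pointInd j (x + c)) i (z + c) = greenOp P N (pointInd j x) i z := by
  simp only [greenOp_apply, walkOp_pow_pointInd_translate]

/-- The Green function up to time `N` is `O(√N)`. -/
theorem HarmonicCorrector.exists_greenOp_pointInd_le (h : HarmonicCorrector P)
    (hP : P ∈ Matrix.rowStochastic ℝ S) (hr : ∀ (i j : S) (z : ℤ), Reaches P i z j) :
    ∃ C : ℝ, 0 ≤ C ∧ ∀ (N : ℕ) (j : S) (x : ℤ) (i : S) (z : ℤ),
      greenOp P N (pointInd j x) i z ≤ C * √N := by
  obtain ⟨r, δ, hδ, hrδ⟩ := h.exists_le_walkOp_pow_dist hP hr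
  have hκ := h.κ_pos
  refine ⟨r * (h.κ * √(r + 1)) / δ, by positivity, fun N j x i z => ?_⟩
  rcases Nat.eq_zero_or_pos N with rfl | hN
  · simp [greenOp_zero]
  set φ := h.dist (h.coord j x)
  -- The r-step gain of the distance dominates the point mass: it is at least δ at the point and
  -- nonnegative elsewhere.
  have hpt : δ • pointInd j x ≤ (walkOp P ^ r) φ - φ := fun a w => by
    simp only [Pi.smul_apply, smul_eq_mul, Pi.sub_apply]
    by_cases haw : a = j ∧ w = x
    · obtain ⟨rfl, rfl⟩ := haw
      rw [pointInd_self, mul_one]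
      have : φ a w = 0 := by simp [φ, HarmonicCorrector.dist]
      rw [this, sub_zero]
      exact hrδ a w
    · rw [pointInd_of_ne haw, mul_zero, sub_nonneg]
      exact h.dist_le_walkOp_pow_dist hP _ r a w
  have h1 := greenOp_mono hP N hpt i z
  -- Telescoping in time leaves r differences over N steps, each of which is controlled by the √N
  -- growth of the mean distance.
  have hcomm : greenOp P N ((walkOp P ^ r) φ - φ)
      = ∑ l ∈ Finset.range r, ((walkOp P ^ (l + N)) φ - (walkOp P ^ l) φ) := by
    have e1 : (walkOp P ^ r) - 1 = (walkOp P - 1) * ∑ l ∈ Finset.range r, walkOp P ^ l :=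
      (mul_geom_sum _ _).symm
    have e2 : (walkOp P ^ N) - 1 = (∑ l ∈ Finset.range N, walkOp P ^ l) * (walkOp P - 1) :=
      (geom_sum_mul _ _).symm
    have e3 : greenOp P N * ((walkOp P ^ r) - 1)
        = ∑ l ∈ Finset.range r, (walkOp P ^ (l + N) - walkOp P ^ l) := by
      rw [e1, ← mul_assoc, greenOp, ← e2, Finset.mul_sum]
      refine Finset.sum_congr rfl fun l _ => ?_
      rw [sub_mul, one_mul, ← pow_add, add_comm]
    have := LinearMap.congr_fun e3 φ
    simpa [LinearMap.sum_apply] using this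
  rw [hcomm, Finset.sum_apply, Finset.sum_apply, map_smul] at h1
  have h2 : ∀ l ∈ Finset.range r, ((walkOp P ^ (l + N)) φ - (walkOp P ^ l) φ) i z
      ≤ h.κ * (√(r + 1) * √N) := fun l hl => by
    have h3 := h.walkOp_pow_dist_le_sqrt hP (h.coord j x) (l + N) i z
    have h4 := h.dist_le_walkOp_pow_dist hP (h.coord j x) l i z
    have h5 : √((l + N : ℕ) : ℝ) ≤ √(r + 1) * √N := by
      rw [← Real.sqrt_mul (by positivity)]
      refine Real.sqrt_le_sqrt ?_
      have hl' : (l : ℝ) ≤ r := by exact_mod_cast (Finset.mem_range.1 hl).le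
      have hN' : (1 : ℝ) ≤ N := by exact_mod_cast hN
      push_cast
      nlinarith [(Nat.cast_nonneg r : (0 : ℝ) ≤ r)]
    have h6 := mul_le_mul_of_nonneg_left h5 hκ.le
    simp only [Pi.sub_apply]
    linarith
  have h7 := Finset.sum_le_sum h2
  rw [Finset.sum_const, Finset.card_range, nsmul_eq_mul] at h7
  have h8 : δ * greenOp P N (pointInd j x) i z ≤ r * (h.κ * (√(r + 1) * √N)) := h1.trans h7
  rw [div_mul_eq_mul_div, le_div_iff₀ hδ]
  linarith

/-- A bounded nonnegative function that is superharmonic off `(o, 0)`, strictly so on a given strip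
around `0`. -/
theorem exists_superharmonic (hP : P ∈ Matrix.rowStochastic ℝ S)
    (hr : ∀ (i j : S) (z : ℤ), Reaches P i z j) (o : S) (Z : ℕ) :
    ∃ (k : S → ℤ → ℝ) (C : ℝ), (∀ i z, 0 ≤ k i z ∧ k i z ≤ C) ∧
      ∀ i z, ¬ (i = o ∧ z = 0) → walkOp P k i z + (if |z| ≤ Z then 1 else 0) ≤ k i z := by
  have hpos : ∀ a : S × ℤ, ∃ q, 0 < (walkOp P ^ q) (pointInd o 0) a.1 a.2 := fun a => by
    obtain ⟨q, hq⟩ := (hr a.1 o (-a.2)).exists_pow_pos hP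
    have := walkOp_pow_pointInd_translate (P := P) q o (-a.2) a.2 a.1 0
    rw [neg_add_cancel, zero_add] at this
    exact ⟨q, by rwa [this]⟩
  choose q hq using hpos
  set W : Finset (S × ℤ) := Finset.univ ×ˢ Finset.Icc (-(Z : ℤ)) Z with hW
  set c : ℝ := ∑ a ∈ W, 1 / (walkOp P ^ q a) (pointInd o 0) a.1 a.2 with hc
  have hc0 : 0 ≤ c := Finset.sum_nonneg fun a _ => (one_div_pos.2 (hq a)).le
  set R : ℕ := ∑ a ∈ W, q a with hR
  set e := pointInd o (0 : ℤ)
  -- Off (o, 0) one has TU - U = ∑ T^(p+1) e over p < R, which is positive on the strip since R is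
  -- at least every hitting time `q a` used there. The factor c raises this gain to at least 1, and
  -- c B - c U is the required function.
  set U : S → ℤ → ℝ := ∑ p ∈ Finset.range R, greenOp P (p + 1) e with hU
  have hTU : walkOp P U + ∑ p ∈ Finset.range R, e
      = U + ∑ p ∈ Finset.range R, (walkOp P ^ (p + 1)) e := by
    rw [hU, map_sum, ← Finset.sum_add_distrib, ← Finset.sum_add_distrib]
    refine Finset.sum_congr rfl fun p _ => ?_
    rw [add_comm, ← greenOp_succ, greenOp, Finset.sum_range_succ, LinearMap.add_apply]
    rfl
  set B : ℝ := ∑ p ∈ Finset.range R, ((p : ℝ) + 1) with hB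
  have hUB : ∀ i z, 0 ≤ U i z ∧ U i z ≤ B := fun i z => by
    simp only [hU, Finset.sum_apply]
    constructor
    · exact Finset.sum_nonneg fun p _ => greenOp_nonneg hP _ (pointInd_nonneg _ _) i z
    · refine Finset.sum_le_sum fun p _ => ?_
      rw [greenOp_apply]
      refine (Finset.sum_le_sum fun l _ => walkOp_pow_pointInd_le_one hP l o 0 i z).trans ?_
      simp
  refine ⟨(fun _ _ => c * B) - c • U, c * B, fun i z => ?_, fun i z hiz => ?_⟩
  · obtain ⟨h1, h2⟩ := hUB i z
    simp only [Pi.sub_apply, Pi.smul_apply, smul_eq_mul]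
    exact ⟨sub_nonneg.2 (mul_le_mul_of_nonneg_left h2 hc0), sub_le_self _ (mul_nonneg hc0 h1)⟩
  · rw [map_sub, map_smul, walkOp_const hP]
    simp only [Pi.sub_apply, Pi.smul_apply, smul_eq_mul]
    have h1 := congrFun (congrFun hTU i) z
    simp only [Pi.add_apply, Finset.sum_apply] at h1
    rw [Finset.sum_eq_zero (s := Finset.range R) (f := fun _ => e i z)
      (fun _ _ => pointInd_of_ne hiz), add_zero] at h1
    have hnn : ∀ p ∈ Finset.range R, 0 ≤ (walkOp P ^ (p + 1)) e i z := fun p _ =>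
      walkOp_pow_pointInd_nonneg hP _ _ _ i z
    have h2 : (if |z| ≤ (Z : ℤ) then (1 : ℝ) else 0)
        ≤ c * ∑ p ∈ Finset.range R, (walkOp P ^ (p + 1)) e i z := by
      split_ifs with hz
      · have haW : (i, z) ∈ W := by
          simp only [hW, Finset.mem_product, Finset.mem_univ, true_and, Finset.mem_Icc]
          exact abs_le.1 hz
        -- The sum starts at exponent 1, so the hitting time must be positive; it is, because (i, z)
        -- is not the target.
        have hq0 : q (i, z) ≠ 0 := fun h0 => by
          have := hq (i, z)
          rw [h0, pow_zero, Module.End.one_apply, show e i z = 0 from pointInd_of_ne hiz] at this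
          exact lt_irrefl _ this
        have hqR : q (i, z) ≤ R := Finset.single_le_sum (fun _ _ => Nat.zero_le _) haW
        have h3 := Finset.single_le_sum hnn (a := q (i, z) - 1) (Finset.mem_range.2 (by omega))
        rw [Nat.sub_add_cancel (Nat.one_le_iff_ne_zero.2 hq0)] at h3
        have h4 := Finset.single_le_sum
          (f := fun a : S × ℤ => 1 / (walkOp P ^ q a) e a.1 a.2)
          (fun a _ => (one_div_pos.2 (hq a)).le) haW
        have h5 := hq (i, z)
        calc (1 : ℝ) = 1 / (walkOp P ^ q (i, z)) e i z * (walkOp P ^ q (i, z)) e i z :=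
              (one_div_mul_cancel h5.ne').symm
          _ ≤ _ := mul_le_mul h4 h3 h5.le hc0
      · exact mul_nonneg hc0 (Finset.sum_nonneg hnn)
    have h3 : c * U i z + c * ∑ p ∈ Finset.range R, (walkOp P ^ (p + 1)) e i z
        = c * walkOp P U i z := by rw [h1]; ring
    linarith

/-- The Green function up to time `N` is Lipschitz in the starting point, uniformly in `N`. -/
theorem HarmonicCorrector.exists_greenOp_pointInd_le_add (h : HarmonicCorrector P)
    (hP : P ∈ Matrix.rowStochastic ℝ S) (hr : ∀ (i j : S) (z : ℤ), Reaches P i z j) :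
    ∃ C : ℝ, 0 ≤ C ∧ ∀ (N : ℕ) (j : S) (x : ℤ) (i o : S) (z w : ℤ),
      greenOp P N (pointInd j x) i z ≤ C * (1 + |(z : ℝ) - w|) + greenOp P N (pointInd j x) o w := by
  obtain ⟨r, δ, hδ, hrδ⟩ := h.exists_le_walkOp_pow_dist hP hr
  have hκ := h.κ_pos
  obtain ⟨Ψ, hΨ0, hΨ⟩ : ∃ Ψ : ℝ, 0 ≤ Ψ ∧ ∀ i, |h.ψ i| ≤ Ψ :=
    ⟨∑ i, |h.ψ i|, Finset.sum_nonneg fun _ _ => abs_nonneg _, fun i =>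
      Finset.single_le_sum (f := fun i => |h.ψ i|) (fun _ _ => abs_nonneg _) (Finset.mem_univ i)⟩
  choose k Ck hk hksup using fun o => exists_superharmonic hP hr o ⌈r * h.κ + Ψ⌉₊
  have hCk : ∀ o, Ck o ≤ ∑ o, |Ck o| := fun o => (le_abs_self _).trans
    (Finset.single_le_sum (f := fun i => |Ck i|) (fun _ _ => abs_nonneg _) (Finset.mem_univ o))
  set K : ℝ := ∑ o, |Ck o| with hK
  have hK0 : 0 ≤ K := Finset.sum_nonneg fun _ _ => abs_nonneg _
  set c₁ : ℝ := r * h.κ with hc₁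
  have hc₁0 : 0 ≤ c₁ := by positivity
  have main : ∀ (N : ℕ) (j : S) (x : ℤ) (i o : S) (z : ℤ),
      greenOp P N (pointInd j x) i z
        ≤ (2 * r * (|(z : ℝ)| + Ψ + c₁) + c₁ * K) / δ + greenOp P N (pointInd j x) o 0 := by
    intro N j x i o z
    set mb := h.coord j x
    -- The function f is nonnegative and at most twice the distance to 0, whatever the pole (j, x);
    -- this removes x from the final constant. Its gain over r steps is at most c₁ on a strip near
    -- 0, minus at least δ at the pole.
    set f : S → ℤ → ℝ := h.dist 0 + (fun _ _ => |mb|) - h.dist mb with hf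
    have hf0 : 0 ≤ f := fun a w => by
      have := abs_sub (h.coord a w) mb
      simp only [hf, Pi.sub_apply, Pi.add_apply, HarmonicCorrector.dist, sub_zero, Pi.zero_apply]
      linarith
    have hf2 : f ≤ (2 : ℝ) • h.dist 0 := fun a w => by
      have := abs_sub_abs_le_abs_sub mb (h.coord a w)
      rw [abs_sub_comm] at this
      simp only [hf, Pi.sub_apply, Pi.add_apply, HarmonicCorrector.dist, sub_zero, Pi.smul_apply,
        smul_eq_mul]
      linarith
    set A : S → ℤ → ℝ := greenOp P r f with hA
    have hA0 : 0 ≤ A := greenOp_nonneg hP r hf0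
    have hAle : ∀ a w, A a w ≤ 2 * r * (|(w : ℝ)| + Ψ + c₁) := fun a w => by
      rw [hA, greenOp_apply]
      have h1 : ∀ l ∈ Finset.range r, (walkOp P ^ l) f a w ≤ 2 * (|(w : ℝ)| + Ψ + c₁) :=
          fun l hl => by
        have h2 := walkOp_pow_mono hP l hf2 a w
        rw [map_smul] at h2
        simp only [Pi.smul_apply, smul_eq_mul] at h2
        have h3 := h.walkOp_pow_dist_le hP 0 l a w
        have h4 : (if h.dist 0 a w < l * h.κ then (l : ℝ) * h.κ else 0) ≤ c₁ := by
          have : (l : ℝ) ≤ r := by exact_mod_cast (Finset.mem_range.1 hl).le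
          have := mul_le_mul_of_nonneg_right this hκ.le
          split_ifs <;> linarith
        have h5 : h.dist 0 a w ≤ |(w : ℝ)| + Ψ := by
          simp only [HarmonicCorrector.dist, sub_zero, HarmonicCorrector.coord]
          exact (abs_add_le _ _).trans (by linarith [hΨ a])
        linarith
      refine (Finset.sum_le_sum h1).trans (le_of_eq ?_)
      rw [Finset.sum_const, Finset.card_range, nsmul_eq_mul]
      ring
    have hTA : walkOp P A = A + ((walkOp P ^ r) f - f) := by
      have h1 : walkOp P A + f = A + (walkOp P ^ r) f := by
        rw [add_comm, hA, ← greenOp_succ, greenOp, Finset.sum_range_succ, LinearMap.add_apply]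
        rfl
      rw [add_sub, ← h1, add_sub_cancel_right]
    -- Here TA - A = T^r f - f, and the superharmonic `k o` absorbs the gain on the strip. After
    -- division by δ, F dominates the point mass plus TF everywhere except at (o, 0).
    set F : S → ℤ → ℝ := (1 / δ) • (A + c₁ • k o) with hF
    have hF0 : 0 ≤ F := fun a w => by
      simp only [hF, Pi.smul_apply, Pi.add_apply, smul_eq_mul, Pi.zero_apply]
      have := hA0 a w
      have := (hk o a w).1
      simp only [Pi.zero_apply] at *
      positivity
    have hFsup : ∀ a w, ¬ (a = o ∧ w = 0) → pointInd j x a w + walkOp P F a w ≤ F a w := by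
      intro a w haw
      have h1 : walkOp P F a w = 1 / δ * (A a w + ((walkOp P ^ r) f a w - f a w)
          + c₁ * walkOp P (k o) a w) := by
        rw [hF, map_smul, map_add, map_smul, hTA]
        simp only [Pi.smul_apply, Pi.add_apply, Pi.sub_apply, smul_eq_mul]
      have h2 : (walkOp P ^ r) f a w - f a w
          = ((walkOp P ^ r) (h.dist 0) a w - h.dist 0 a w)
            - ((walkOp P ^ r) (h.dist mb) a w - h.dist mb a w) := by
        rw [hf, map_sub, map_add, walkOp_pow_const hP]
        simp only [Pi.add_apply, Pi.sub_apply]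
        ring
      have h3 : (walkOp P ^ r) (h.dist 0) a w - h.dist 0 a w
          ≤ c₁ * if |w| ≤ ((⌈r * h.κ + Ψ⌉₊ : ℕ) : ℤ) then 1 else 0 := by
        have h4 := h.walkOp_pow_dist_le hP 0 r a w
        by_cases hw : h.dist 0 a w < r * h.κ
        · rw [if_pos hw] at h4
          rw [if_pos]
          · linarith
          · simp only [HarmonicCorrector.dist, sub_zero, HarmonicCorrector.coord] at hw
            have h5 := abs_sub_abs_le_abs_sub (w : ℝ) (-h.ψ a)
            rw [sub_neg_eq_add, abs_neg] at h5
            have h6 : ((|w| : ℤ) : ℝ) ≤ ⌈r * h.κ + Ψ⌉₊ := by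
              push_cast
              exact le_trans (by linarith [hΨ a]) (Nat.le_ceil _)
            exact_mod_cast h6
        · rw [if_neg hw] at h4
          refine (show _ ≤ (0 : ℝ) by linarith).trans (mul_nonneg hc₁0 ?_)
          split_ifs <;> norm_num
      have h4 : δ * pointInd j x a w
          ≤ (walkOp P ^ r) (h.dist mb) a w - h.dist mb a w := by
        by_cases hjx : a = j ∧ w = x
        · obtain ⟨rfl, rfl⟩ := hjx
          rw [pointInd_self, mul_one]
          have : h.dist mb a w = 0 := by simp [mb, HarmonicCorrector.dist]
          rw [this, sub_zero]
          exact hrδ a w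
        · rw [pointInd_of_ne hjx, mul_zero, sub_nonneg]
          exact h.dist_le_walkOp_pow_dist hP _ r a w
      have h5 := mul_le_mul_of_nonneg_left (hksup o a w haw) hc₁0
      rw [h1, hF]
      simp only [Pi.smul_apply, Pi.add_apply, smul_eq_mul]
      rw [one_div_mul_eq_div, one_div_mul_eq_div, ← mul_le_mul_iff_of_pos_left hδ, mul_add,
        mul_div_cancel₀ _ hδ.ne', mul_div_cancel₀ _ hδ.ne', h2]
      linarith
    -- Maximum principle by induction on time: off (o, 0) use the supersolution F; at (o, 0) the
    -- claim reduces to F ≥ 0.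
    have hind : ∀ N a w, greenOp P N (pointInd j x) a w
        ≤ F a w + greenOp P N (pointInd j x) o 0 := by
      intro N
      induction N with
      | zero =>
        intro a w
        have := hF0 a w
        simpa [greenOp_zero] using this
      | succ N ih =>
        intro a w
        by_cases haw : a = o ∧ w = 0
        · obtain ⟨rfl, rfl⟩ := haw
          exact le_add_of_nonneg_left (hF0 _ _)
        · have h1 := walkOp_mono hP
            (g := F + fun _ _ => greenOp P N (pointInd j x) o 0) ih a w
          rw [map_add, walkOp_const hP] at h1
          have h2 := greenOp_le_succ hP N (pointInd_nonneg j x) o 0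
          have h3 := hFsup a w haw
          have h4 := congrFun (congrFun (greenOp_succ (P := P) N (pointInd j x)) a) w
          simp only [Pi.add_apply] at h1 h4
          linarith
    refine (hind N i z).trans (add_le_add_left ?_ _)
    rw [hF]
    simp only [Pi.smul_apply, Pi.add_apply, smul_eq_mul]
    rw [one_div_mul_eq_div]
    gcongr
    · exact hAle i z
    · exact (hk o i z).2.trans (hCk o)
  -- Translation by w moves the reference point (o, w) to (o, 0).
  refine ⟨(2 * r * (1 + Ψ + c₁) + c₁ * K) / δ, by positivity, fun N j x i o z w => ?_⟩
  have h1 := main N j (x - w) i o (z - w)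
  have h2 := greenOp_pointInd_translate (P := P) N j (x - w) w i (z - w)
  have h3 := greenOp_pointInd_translate (P := P) N j (x - w) w o 0
  rw [sub_add_cancel, sub_add_cancel] at h2
  rw [sub_add_cancel, zero_add] at h3
  rw [h2, h3]
  refine h1.trans (add_le_add_left ?_ _)
  rw [div_mul_eq_mul_div]
  push_cast
  refine div_le_div_of_nonneg_right ?_ hδ.le
  have h4 : 0 ≤ |(z : ℝ) - w| := abs_nonneg _
  have h5 : (0 : ℝ) ≤ r := Nat.cast_nonneg r
  have h6 : 0 ≤ (c₁ * K) * |(z : ℝ) - w| := by positivity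
  have h7 : 0 ≤ 2 * r * ((Ψ + c₁) * |(z : ℝ) - w|) := by positivity
  linarith

/-- The Green function of a level up to time `N` is `O(√N)`. -/
theorem HarmonicCorrector.exists_greenOp_levelInd_le (h : HarmonicCorrector P)
    (hP : P ∈ Matrix.rowStochastic ℝ S) (hr : ∀ (i j : S) (z : ℤ), Reaches P i z j) :
    ∃ C : ℝ, 0 ≤ C ∧ ∀ (N : ℕ) (x : ℤ) (i : S) (z : ℤ),
      greenOp P N (levelInd S x) i z ≤ C * √N := by
  obtain ⟨C, hC, hCle⟩ := h.exists_greenOp_pointInd_le hP hr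
  refine ⟨∑ _j : S, C, Finset.sum_nonneg fun _ _ => hC, fun N x i z => ?_⟩
  rw [levelInd_eq_sum, map_sum, Finset.sum_apply, Finset.sum_apply, Finset.sum_mul]
  exact Finset.sum_le_sum fun j _ => hCle N j x i z

/-- The Green function of a level is Lipschitz in the level, uniformly in time. -/
theorem HarmonicCorrector.exists_abs_greenOp_levelInd_sub_le (h : HarmonicCorrector P)
    (hP : P ∈ Matrix.rowStochastic ℝ S) (hr : ∀ (i j : S) (z : ℤ), Reaches P i z j) :
    ∃ C : ℝ, 0 ≤ C ∧ ∀ (N : ℕ) (x y : ℤ) (i : S) (z : ℤ),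
      |greenOp P N (levelInd S x - levelInd S y) i z| ≤ C * (1 + |(x : ℝ) - y|) := by
  obtain ⟨C, hC, hCle⟩ := h.exists_greenOp_pointInd_le_add hP hr
  have key : ∀ (N : ℕ) (x y : ℤ) (i : S) (z : ℤ),
      greenOp P N (levelInd S x - levelInd S y) i z ≤ (∑ _j : S, C) * (1 + |(x : ℝ) - y|) := by
    intro N x y i z
    rw [levelInd_eq_sum, levelInd_eq_sum, ← Finset.sum_sub_distrib, map_sum, Finset.sum_apply,
      Finset.sum_apply, Finset.sum_mul]
    refine Finset.sum_le_sum fun j _ => ?_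
    rw [map_sub, Pi.sub_apply, Pi.sub_apply, sub_le_iff_le_add]
    -- Replacing level y by level x amounts to shifting the starting point by x - y, where the
    -- Lipschitz bound applies.
    have h1 := greenOp_pointInd_translate (P := P) N j y (x - y) i z
    rw [add_sub_cancel] at h1
    have h2 := hCle N j x i i z (z + (x - y))
    have h3 : |(z : ℝ) - (z + (x - y) : ℤ)| = |(x : ℝ) - y| := by
      push_cast
      rw [show (z : ℝ) - (z + (x - y)) = -(x - y) by ring, abs_neg]
    rwa [h1, h3] at h2
  refine ⟨∑ _j : S, C, Finset.sum_nonneg fun _ _ => hC, fun N x y i z => abs_le'.2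
    ⟨key N x y i z, ?_⟩⟩
  have h1 := key N y x i z
  rw [← neg_sub (levelInd S x), map_neg, abs_sub_comm] at h1
  exact h1

end Green

/-! ### Exponential moments of additive functionals -/

/-- The function of the Green potentials that dominates the exponential moments. -/
noncomputable def expMajorant (G R : ℝ) : ℝ := Real.exp G * (1 + R - R ^ 2) - 4 * G ^ 2

/-- The graph lies below its tangent planes on the small box, so Jensen's inequality holds for one
step of the walk. The term -4G² beats the convexity of the exponential, which costs at most
2(G'-G)², and -R² controls the mixed term. -/
theorem expMajorant_le_tangent {G R G' R' : ℝ} (hG : |G| ≤ 1 / 8) (hG' : |G'| ≤ 1 / 8)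
    (hR : 0 ≤ R) (hR8 : R ≤ 1 / 8) (hR' : 0 ≤ R') (hR'8 : R' ≤ 1 / 8) :
    expMajorant G' R' ≤ expMajorant G R
      + (Real.exp G * (1 + R - R ^ 2) - 8 * G) * (G' - G)
      + Real.exp G * (1 - 2 * R) * (R' - R) := by
  rw [abs_le] at hG hG'
  set D := G' - G with hD
  have hD1 : |D| ≤ 1 := abs_le.2 ⟨by linarith, by linarith⟩
  have hexpD : Real.exp D ≤ 1 + D + D ^ 2 := by
    have := le_of_abs_le (Real.abs_exp_sub_one_sub_id_le hD1)
    linarith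
  have hG'e : G' = G + D := by rw [hD]; ring
  have hexpG : Real.exp G ≤ 4 / 3 := by
    have h1 : |G| ≤ 1 := abs_le.2 ⟨by linarith, by linarith⟩
    have := le_of_abs_le (Real.abs_exp_sub_one_sub_id_le h1)
    nlinarith
  have hφ : 0 ≤ 1 + R' - R' ^ 2 := by nlinarith
  have h1 : Real.exp D * (1 + R' - R' ^ 2) - (1 + R - R ^ 2) * (1 + D) - (1 - 2 * R) * (R' - R)
      ≤ 3 / 2 * D ^ 2 := by
    have h2 := mul_le_mul_of_nonneg_right hexpD hφ
    have h3 : (1 - R - R') ^ 2 ≤ 1 := by nlinarith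
    have h4 : D * ((1 - R - R') * (R' - R)) - (R' - R) ^ 2 ≤ D ^ 2 / 4 := by
      nlinarith [sq_nonneg (D / 2 * (1 - R - R') - (R' - R)),
        mul_le_mul_of_nonneg_left h3 (sq_nonneg D)]
    have h5 : D ^ 2 * (1 + R' - R' ^ 2) ≤ D ^ 2 * (5 / 4) :=
      mul_le_mul_of_nonneg_left (by nlinarith) (sq_nonneg D)
    nlinarith
  have h2 := mul_le_mul_of_nonneg_left h1 (Real.exp_pos G).le
  have h3 := mul_le_mul_of_nonneg_right hexpG (show 0 ≤ 3 / 2 * D ^ 2 by positivity)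
  have h4 : Real.exp G' = Real.exp G * Real.exp D := by rw [hG'e, Real.exp_add]
  unfold expMajorant
  rw [h4, hG'e]
  nlinarith [sq_nonneg D]

/-- Multiplication by e^u shifts G exactly in the exponential part. The quadratic part costs at most
(8 + 4 + 4) η|u|, while raising R by s gains at least s/4; this is where 64 comes from. -/
theorem exp_mul_expMajorant_le {G R u s η : ℝ} (hη : η ≤ 1 / 8) (hG : |G| ≤ η) (hu : |u| ≤ η)
    (hs : 64 * η * |u| ≤ s) (hRs : R + s ≤ 1 / 8) :
    Real.exp u * expMajorant G R ≤ expMajorant (u + G) (s + R) := by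
  have hη0 : 0 ≤ η := (abs_nonneg _).trans hG
  have hu0 := abs_nonneg u
  have hs0 : 0 ≤ s := (by positivity : 0 ≤ 64 * η * |u|).trans hs
  have hGu : 1 / 2 ≤ Real.exp (u + G) := by
    have := Real.add_one_le_exp (u + G)
    have := neg_le_of_abs_le hG
    have := neg_le_of_abs_le hu
    linarith
  have h1 : s / 4 ≤ Real.exp (u + G) * (s * (1 - 2 * R - s)) := by
    have : 1 / 2 * (s * (1 / 2)) ≤ Real.exp (u + G) * (s * (1 - 2 * R - s)) :=
      mul_le_mul hGu (mul_le_mul_of_nonneg_left (by linarith) hs0) (by positivity) (by positivity)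
    linarith
  have h2 : Real.exp u * Real.exp G = Real.exp (u + G) := (Real.exp_add u G).symm
  have hG2 : G ^ 2 ≤ η := by
    rw [← sq_abs]
    nlinarith [abs_nonneg G]
  have h3 : -(|u| * η) ≤ (Real.exp u - 1) * G ^ 2 := by
    have h4 : -|u| ≤ Real.exp u - 1 := by
      linarith [Real.add_one_le_exp u, neg_abs_le u]
    nlinarith [mul_le_mul_of_nonneg_left hG2 hu0, mul_le_mul_of_nonneg_right h4 (sq_nonneg G)]
  have h4 : G * u ≤ |u| * η := by
    refine (le_abs_self _).trans ?_
    rw [abs_mul, mul_comm]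
    exact mul_le_mul_of_nonneg_left hG hu0
  have h5 : u ^ 2 ≤ |u| * η := by
    rw [← sq_abs, sq]
    exact mul_le_mul_of_nonneg_left hu hu0
  unfold expMajorant
  rw [mul_sub, ← mul_assoc, h2]
  nlinarith

section ExpMoment

variable {S : Finset ℤ} {P : Matrix S S ℝ}

/-- The transition operator with multiplicative weight `f`. -/
noncomputable def weightedOp (P : Matrix S S ℝ) (f u : S → ℤ → ℝ) : S → ℤ → ℝ :=
  fun i z => f i z * walkOp P u i z

/-- A Khas'minskii-type bound that exploits cancellation: the potential of |v| appears only with the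
extra factor η, a bound on the signed potential θ G v. By induction on time the weighted iterate is
at most `expMajorant` of the two potentials, since G_{M+1} v = v + T G_M v: T is handled by the
tangent inequality and the weight by the multiplicative one. -/
theorem iterate_weightedOp_exp_le (hP : P ∈ Matrix.rowStochastic ℝ S) {v : S → ℤ → ℝ} {θ η : ℝ}
    {N : ℕ} (hθ : 0 ≤ θ) (hη : η ≤ 1 / 8) (hv : ∀ i z, |θ * v i z| ≤ η)
    (hG : ∀ M ≤ N, ∀ i z, |θ * greenOp P M v i z| ≤ η)
    (hR : ∀ M ≤ N, ∀ i z, 64 * η * θ * greenOp P M (fun i z => |v i z|) i z ≤ 1 / 8)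
    (i : S) (z : ℤ) : (weightedOp P fun i z => Real.exp (θ * v i z))^[N] 1 i z ≤ 2 := by
  have hη0 : 0 ≤ η := (abs_nonneg _).trans (hv i z)
  set a : S → ℤ → ℝ := fun i z => |v i z|
  have ha : 0 ≤ a := fun i z => abs_nonneg _
  have hgn : ∀ M i z, 0 ≤ 64 * η * θ * greenOp P M a i z := fun M i z =>
    mul_nonneg (by positivity) (greenOp_nonneg hP M ha i z)
  have key : ∀ M ≤ N, ∀ i z, (weightedOp P fun i z => Real.exp (θ * v i z))^[M] 1 i z
      ≤ expMajorant (θ * greenOp P M v i z) (64 * η * θ * greenOp P M a i z) := by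
    intro M
    induction M with
    | zero =>
      intro _ i z
      simp [greenOp_zero, expMajorant]
    | succ M ih =>
      intro hM i z
      have hM' : M ≤ N := by omega
      rw [Function.iterate_succ_apply']
      set g := fun (j : S) => θ * greenOp P M v j (z + j) with hg
      set r := fun (j : S) => 64 * η * θ * greenOp P M a j (z + j) with hr
      set g₀ := ∑ j, P i j * g j with hg₀
      set r₀ := ∑ j, P i j * r j with hr₀
      have hs := Matrix.sum_row_of_mem_rowStochastic hP i
      have hpn : ∀ j, 0 ≤ P i j := fun j => Matrix.nonneg_of_mem_rowStochastic hP
      have hgS : θ * greenOp P (M + 1) v i z = θ * v i z + g₀ := by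
        rw [greenOp_succ, Pi.add_apply, Pi.add_apply, mul_add, walkOp_apply, Finset.mul_sum]
        congr 1
        exact Finset.sum_congr rfl fun j _ => by rw [hg]; ring
      have hrS : 64 * η * θ * greenOp P (M + 1) a i z = 64 * η * θ * a i z + r₀ := by
        rw [greenOp_succ, Pi.add_apply, Pi.add_apply, mul_add, walkOp_apply, Finset.mul_sum]
        congr 1
        exact Finset.sum_congr rfl fun j _ => by rw [hr]; ring
      have hg₀η : |g₀| ≤ η := by
        refine (Finset.abs_sum_le_sum_abs _ _).trans ?_
        calc ∑ j, |P i j * g j| ≤ ∑ j, P i j * η := Finset.sum_le_sum fun j _ => by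
              rw [abs_mul, abs_of_nonneg (hpn j)]
              exact mul_le_mul_of_nonneg_left (hG M hM' j _) (hpn j)
          _ = η := by rw [← Finset.sum_mul, hs, one_mul]
      have hr₀0 : 0 ≤ r₀ := Finset.sum_nonneg fun j _ => mul_nonneg (hpn j) (hgn M j _)
      have hsum : 64 * η * θ * a i z + r₀ ≤ 1 / 8 := by rw [← hrS]; exact hR _ hM i z
      have ha0 : 0 ≤ 64 * η * θ * a i z := mul_nonneg (by positivity) (ha i z)
      have hjen : ∑ j, P i j * expMajorant (g j) (r j) ≤ expMajorant g₀ r₀ := by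
        have h1 : ∀ j ∈ Finset.univ, P i j * expMajorant (g j) (r j)
            ≤ P i j * (expMajorant g₀ r₀
              + (Real.exp g₀ * (1 + r₀ - r₀ ^ 2) - 8 * g₀) * (g j - g₀)
              + Real.exp g₀ * (1 - 2 * r₀) * (r j - r₀)) := fun j _ =>
          mul_le_mul_of_nonneg_left (expMajorant_le_tangent (hg₀η.trans hη)
            ((hG M hM' j _).trans hη) hr₀0 (by linarith) (hgn M j _) (hR M hM' j _)) (hpn j)
        refine (Finset.sum_le_sum h1).trans (le_of_eq ?_)
        set A := Real.exp g₀ * (1 + r₀ - r₀ ^ 2) - 8 * g₀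
        set B := Real.exp g₀ * (1 - 2 * r₀)
        have h2 : ∀ j, P i j * (expMajorant g₀ r₀ + A * (g j - g₀) + B * (r j - r₀))
            = P i j * (expMajorant g₀ r₀ - A * g₀ - B * r₀) + A * (P i j * g j)
              + B * (P i j * r j) := fun j => by ring
        simp only [h2, Finset.sum_add_distrib, ← Finset.sum_mul, ← Finset.mul_sum, hs,
          ← hg₀, ← hr₀]
        ring
      have hT : walkOp P ((weightedOp P fun i z => Real.exp (θ * v i z))^[M] 1) i z
          ≤ expMajorant g₀ r₀ := by
        refine le_trans ?_ hjen
        rw [walkOp_apply]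
        exact Finset.sum_le_sum fun j _ => mul_le_mul_of_nonneg_left (ih hM' j _) (hpn j)
      rw [hgS, hrS]
      refine (mul_le_mul_of_nonneg_left hT (Real.exp_pos _).le).trans ?_
      refine exp_mul_expMajorant_le hη hg₀η (hv i z) (le_of_eq ?_) (by linarith)
      rw [abs_mul, abs_of_nonneg hθ]
      ring
  refine (key N le_rfl i z).trans ?_
  have h1 := abs_le.1 ((hG N le_rfl i z).trans hη)
  have h2 := hR N le_rfl i z
  have h3 := hgn N i z
  set G := θ * greenOp P N v i z
  set R := 64 * η * θ * greenOp P N a i z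
  have hexpG : Real.exp G ≤ 4 / 3 := by
    have h1' : |G| ≤ 1 := abs_le.2 ⟨by linarith, by linarith⟩
    have := le_of_abs_le (Real.abs_exp_sub_one_sub_id_le h1')
    nlinarith
  -- The product is 3/2, below the claimed bound 2.
  have h5 : Real.exp G * (1 + R - R ^ 2) ≤ 4 / 3 * (9 / 8) :=
    mul_le_mul hexpG (by nlinarith) (by nlinarith) (by norm_num)
  unfold expMajorant
  nlinarith [sq_nonneg G]

/-- Exponential moments of differences of level visits, on the scale `(|x - y| √n) ^ (1/2)`. -/
theorem HarmonicCorrector.exists_iterate_weightedOp_le (h : HarmonicCorrector P)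
    (hP : P ∈ Matrix.rowStochastic ℝ S) (hr : ∀ (i j : S) (z : ℤ), Reaches P i z j) :
    ∃ C : ℝ, 0 ≤ C ∧ ∀ (n : ℕ) (x y : ℤ), 1 ≤ n → x ≠ y → (x - y) ^ 2 ≤ n → ∃ θ : ℝ, 0 < θ ∧
      1 ≤ C * θ ^ 4 * (((x : ℝ) - y) ^ 2 * n) ∧ ∀ i z,
        (weightedOp P fun i z => Real.exp (θ * (levelInd S x - levelInd S y) i z))^[n + 1] 1 i z
          ≤ 2 ∧
        (weightedOp P fun i z => Real.exp (θ * (levelInd S y - levelInd S x) i z))^[n + 1] 1 i z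
          ≤ 2 := by
  obtain ⟨C₁, hC₁, h₁⟩ := h.exists_abs_greenOp_levelInd_sub_le hP hr
  obtain ⟨C₂, hC₂, h₂⟩ := h.exists_greenOp_levelInd_le hP hr
  -- The term 2C₁ covers 1 + d ≤ 2d, 4C₂ covers two levels up to time n + 1 with √(n+1) ≤ 2√n, and 1
  -- covers |v| ≤ 1.
  set C : ℝ := 2 * C₁ + 4 * C₂ + 1 with hC
  have hC1 : 1 ≤ C := by linarith
  refine ⟨(32 * C) ^ 4, by positivity, fun n x y hn hxy hxyn => ?_⟩
  set d : ℝ := |(x : ℝ) - y| with hd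
  have hd1 : 1 ≤ d := by
    have : (1 : ℤ) ≤ |x - y| := Int.one_le_abs (sub_ne_zero.2 hxy)
    rw [hd]
    exact_mod_cast this
  have hnpos : (1 : ℝ) ≤ n := by exact_mod_cast hn
  set q : ℝ := √n with hq
  have hq2 : q ^ 2 = n := Real.sq_sqrt (by linarith)
  have hq1 : 1 ≤ q := Real.one_le_sqrt.2 hnpos
  have hdq : d ≤ q := by
    refine Real.le_sqrt_of_sq_le ?_
    rw [hd, sq_abs]
    exact_mod_cast hxyn
  set p : ℝ := √(d * q) with hp
  have hp2 : p ^ 2 = d * q := Real.sq_sqrt (by positivity)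
  have hp0 : 0 < p := Real.sqrt_pos.2 (by positivity)
  have hdp : d ≤ p := Real.le_sqrt_of_sq_le (by nlinarith)
  -- With η = θCd, the R-term is at most 64 θ² C² d√n = 64/1024 = 1/16. The assumption (x-y)² ≤ n
  -- gives d ≤ p, hence η ≤ 1/32.
  set θ : ℝ := 1 / (32 * C * p) with hθ
  have hθ0 : 0 < θ := by positivity
  have hη : θ * C * d ≤ 1 / 32 := by
    rw [hθ, div_mul_eq_mul_div, div_mul_eq_mul_div, div_le_div_iff₀ (by positivity) (by norm_num)]
    nlinarith
  have main : ∀ x y : ℤ, |(x : ℝ) - y| = d → ∀ i z,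
      (weightedOp P fun i z => Real.exp (θ * (levelInd S x - levelInd S y) i z))^[n + 1] 1 i z
        ≤ 2 := by
    intro x y hxyd
    have hvabs : ∀ i z, |(levelInd S x - levelInd S y) i z| ≤ levelInd S x i z + levelInd S y i z :=
      fun i z => by
        have h1 := levelInd_nonneg (S := S) x i z
        have h2 := levelInd_nonneg (S := S) y i z
        simp only [Pi.zero_apply] at h1 h2
        rw [Pi.sub_apply, Pi.sub_apply, abs_le]
        constructor <;> linarith
    have hv1 : ∀ i z, |(levelInd S x - levelInd S y) i z| ≤ 1 := fun i z => by
      simp only [Pi.sub_apply, levelInd]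
      split_ifs <;> norm_num
    refine iterate_weightedOp_exp_le hP (η := θ * C * d) hθ0.le (by linarith) (fun i z => ?_)
      (fun M hM i z => ?_) (fun M hM i z => ?_)
    · rw [abs_mul, abs_of_pos hθ0, mul_assoc]
      refine mul_le_mul_of_nonneg_left ((hv1 i z).trans ?_) hθ0.le
      nlinarith
    · rw [abs_mul, abs_of_pos hθ0, mul_assoc]
      refine mul_le_mul_of_nonneg_left ((h₁ M x y i z).trans ?_) hθ0.le
      rw [hxyd]
      nlinarith
    · have h3 : greenOp P M (fun i z => |(levelInd S x - levelInd S y) i z|) i z ≤ C * q := by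
        have h4 := greenOp_mono hP M (g := levelInd S x + levelInd S y) hvabs i z
        rw [map_add, Pi.add_apply, Pi.add_apply] at h4
        have h5 := h₂ M x i z
        have h6 := h₂ M y i z
        have h7 : √(M : ℝ) ≤ 2 * q := by
          rw [Real.sqrt_le_iff]
          refine ⟨by positivity, ?_⟩
          have : (M : ℝ) ≤ n + 1 := by exact_mod_cast hM
          nlinarith
        have h8 := mul_le_mul_of_nonneg_left h7 hC₂
        nlinarith
      have h9 := mul_le_mul_of_nonneg_left h3 (show 0 ≤ 64 * (θ * C * d) * θ by positivity)
      refine h9.trans (le_of_eq_of_le (b := 1 / 16) ?_ (by norm_num))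
      have h10 : θ * (32 * C * p) = 1 := by rw [hθ]; field_simp
      have h11 : (θ * (32 * C * p)) ^ 2 = 1 := by rw [h10, one_pow]
      have h12 : (θ * (32 * C * p)) ^ 2 = 1024 * (θ ^ 2 * C ^ 2 * (d * q)) := by rw [← hp2]; ring
      linear_combination (h11 - h12) / 16
  refine ⟨θ, hθ0, ?_, fun i z => ⟨main x y rfl i z, main y x (abs_sub_comm _ _) i z⟩⟩
  have h1 : ((x : ℝ) - y) ^ 2 * n = p ^ 4 := by
    rw [show p ^ 4 = (p ^ 2) ^ 2 by ring, hp2, mul_pow, hq2, hd, sq_abs]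
  have h2 : (32 * C) ^ 4 * θ ^ 4 * p ^ 4 = (θ * (32 * C * p)) ^ 4 := by ring
  have h10 : θ * (32 * C * p) = 1 := by rw [hθ]; field_simp
  rw [h1, h2, h10, one_pow]

end ExpMoment

/-! ### Path functionals of the Markov chain -/

section Paths

variable {Ω : Type*} {S : Finset ℤ} {X : ℕ → Ω → S}

/-- The path of the chain up to time `n`. -/
def pathUpTo (X : ℕ → Ω → S) (n : ℕ) (ω : Ω) : Fin (n + 1) → S := fun k => X k ω

/-- Factoring through the finite set of paths reduces measurability and integrability to finite
spaces. -/
theorem exists_eq_comp_pathUpTo {β : Type*} [Nonempty β] {n : ℕ} {A : Ω → β}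
    (hA : ∀ ω ω', (∀ k ≤ n, X k ω = X k ω') → A ω = A ω') :
    ∃ a : (Fin (n + 1) → S) → β, A = a ∘ pathUpTo X n := by
  rw [← Function.factorsThrough_iff]
  refine fun ω ω' h => hA ω ω' fun k hk => ?_
  exact congrFun h ⟨k, Nat.lt_succ_of_le hk⟩

theorem partialSum_congr {n k : ℕ} (hk : k ≤ n) {ω ω' : Ω} (h : ∀ k ≤ n, X k ω = X k ω') :
    partialSum X k ω = partialSum X k ω' := by
  refine Finset.sum_congr rfl fun l hl => ?_
  rw [h l ((Nat.le_of_lt_succ (Finset.mem_range.1 hl)).trans hk)]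

theorem visitCount_congr {n : ℕ} {ω ω' : Ω} (h : ∀ k ≤ n, X k ω = X k ω') (x : ℤ) :
    visitCount X n x ω = visitCount X n x ω' := by
  unfold visitCount
  refine congrArg _ (Finset.filter_congr fun k hk => ?_)
  rw [partialSum_congr (Nat.le_of_lt_succ (Finset.mem_range.1 hk)) h]

theorem visitCount_eq_sum (n : ℕ) (x : ℤ) (ω : Ω) :
    (visitCount X n x ω : ℝ)
      = ∑ k ∈ Finset.range (n + 1), if partialSum X k ω = x then (1 : ℝ) else 0 := by
  rw [visitCount, Finset.sum_boole]

end Paths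

/-! ### Markov property, Feynman–Kac formula and tail bounds for visit counts -/

section MarkovChain

variable {Ω : Type*} [MeasurableSpace Ω] {ℙ : Measure Ω} {S : Finset ℤ} {P : Matrix S S ℝ}
  {μ : S → ℝ} {X : ℕ → Ω → S}

theorem integral_comp_eq_sum [IsFiniteMeasure ℙ] {α : Type*} [Fintype α] [MeasurableSpace α]
    [MeasurableSingletonClass α] {Y : Ω → α} (hY : Measurable Y) (F : α → ℝ) :
    ∫ ω, F (Y ω) ∂ℙ = ∑ a, ℙ.real (Y ⁻¹' {a}) * F a := by
  rw [← integral_map hY.aemeasurable (measurable_of_finite F).aestronglyMeasurable,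
    integral_fintype Integrable.of_finite]
  refine Finset.sum_congr rfl fun a _ => ?_
  rw [map_measureReal_apply hY (measurableSet_singleton a), smul_eq_mul]

theorem IsMarkovChain.measurable_pathUpTo (hX : IsMarkovChain ℙ S P μ X) (n : ℕ) :
    Measurable (pathUpTo X n) := measurable_pi_lambda _ fun k => hX.1 k

theorem IsMarkovChain.measurable_of_path (hX : IsMarkovChain ℙ S P μ X) {β : Type*} [Nonempty β]
    [MeasurableSpace β] {n : ℕ} {A : Ω → β}
    (hA : ∀ ω ω', (∀ k ≤ n, X k ω = X k ω') → A ω = A ω') : Measurable A := by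
  obtain ⟨a, rfl⟩ := exists_eq_comp_pathUpTo hA
  exact (measurable_of_finite a).comp (hX.measurable_pathUpTo n)

theorem IsMarkovChain.integrable_of_path [IsFiniteMeasure ℙ] (hX : IsMarkovChain ℙ S P μ X)
    {n : ℕ} {A : Ω → ℝ} (hA : ∀ ω ω', (∀ k ≤ n, X k ω = X k ω') → A ω = A ω') :
    Integrable A ℙ := by
  obtain ⟨a, rfl⟩ := exists_eq_comp_pathUpTo hA
  exact (Integrable.of_finite (μ := ℙ.map (pathUpTo X n)) (f := a)).comp_measurable
    (hX.measurable_pathUpTo n)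

theorem IsMarkovChain.real_pathUpTo_eq (hX : IsMarkovChain ℙ S P μ X) (n : ℕ)
    (s : Fin (n + 1) → S) (j : S) :
    ℙ.real ((fun ω => (pathUpTo X n ω, X (n + 1) ω)) ⁻¹' {(s, j)})
      = ℙ.real (pathUpTo X n ⁻¹' {s}) * P (s (Fin.last n)) j := by
  -- Extending the path by the constant j supplies the value at time n + 1, so one sequence
  -- describes both cylinders.
  set t : ℕ → S := fun k => if h : k < n + 1 then s ⟨k, h⟩ else j with ht
  have htk : ∀ k (h : k < n + 1), t k = s ⟨k, h⟩ := fun k h => dif_pos h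
  have h1 : pathUpTo X n ⁻¹' {s} = {ω | ∀ k ≤ n, X k ω = t k} := by
    ext ω
    simp only [Set.mem_preimage, Set.mem_singleton_iff, funext_iff, pathUpTo]
    exact ⟨fun h k hk => (h ⟨k, Nat.lt_succ_of_le hk⟩).trans (htk k _).symm,
      fun h k => (h k (Nat.le_of_lt_succ k.2)).trans (htk k k.2)⟩
  have h2 : (fun ω => (pathUpTo X n ω, X (n + 1) ω)) ⁻¹' {(s, j)}
      = {ω | ∀ k ≤ n + 1, X k ω = t k} := by
    have h3 : (fun ω => (pathUpTo X n ω, X (n + 1) ω)) ⁻¹' {(s, j)}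
        = pathUpTo X n ⁻¹' {s} ∩ {ω | X (n + 1) ω = j} := by
      ext ω
      simp
    rw [h3, h1]
    ext ω
    have : t (n + 1) = j := dif_neg (lt_irrefl _)
    constructor
    · rintro ⟨ha, hb⟩ k hk
      rcases hk.lt_or_eq with hlt | rfl
      · exact ha k (Nat.le_of_lt_succ hlt)
      · rw [this]; exact hb
    · exact fun h => ⟨fun k hk => h k (hk.trans (Nat.le_succ n)), (h (n + 1) le_rfl).trans this⟩
  rw [h1, h2, hX.2 n t, hX.2 (n + 1) t, Finset.prod_range_succ, ← mul_assoc]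
  congr 2
  · exact htk n (Nat.lt_succ_self n)
  · exact dif_neg (lt_irrefl _)

/-- The Markov property. -/
theorem IsMarkovChain.integral_succ [IsFiniteMeasure ℙ] (hX : IsMarkovChain ℙ S P μ X) (n : ℕ)
    {A : Ω → S → ℝ} (hA : ∀ ω ω', (∀ k ≤ n, X k ω = X k ω') → A ω = A ω') :
    ∫ ω, A ω (X (n + 1) ω) ∂ℙ = ∫ ω, ∑ j, P (X n ω) j * A ω j ∂ℙ := by
  obtain ⟨a, rfl⟩ := exists_eq_comp_pathUpTo hA
  have h1 := integral_comp_eq_sum (ℙ := ℙ)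
    ((hX.measurable_pathUpTo n).prodMk (hX.1 (n + 1))) (fun p => a p.1 p.2)
  have h2 := integral_comp_eq_sum (ℙ := ℙ) (hX.measurable_pathUpTo n)
    (fun s => ∑ j, P (s (Fin.last n)) j * a s j)
  refine h1.trans (Eq.trans ?_ h2.symm)
  rw [Fintype.sum_prod_type]
  refine Finset.sum_congr rfl fun s _ => ?_
  rw [Finset.mul_sum]
  refine Finset.sum_congr rfl fun j _ => ?_
  rw [hX.real_pathUpTo_eq, mul_assoc]

/-- The Feynman–Kac formula for the walk `(X_k, S_k)`. -/
theorem IsMarkovChain.integral_prod_mul [IsFiniteMeasure ℙ] (hX : IsMarkovChain ℙ S P μ X)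
    (f : S → ℤ → ℝ) (n : ℕ) (u : S → ℤ → ℝ) :
    ∫ ω, (∏ k ∈ Finset.range n, f (X k ω) (partialSum X k ω)) * u (X n ω) (partialSum X n ω) ∂ℙ
      = ∑ i : S, μ i * (weightedOp P f)^[n] u i i := by
  induction n generalizing u with
  | zero =>
    simp only [Finset.range_zero, Finset.prod_empty, one_mul, Function.iterate_zero, id,
      partialSum, zero_add, Finset.sum_range_one]
    -- The walk starts with S_0 = X_0, hence the diagonal evaluation at (i, i).
    rw [integral_comp_eq_sum (ℙ := ℙ) (hX.1 0) fun i => u i i]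
    refine Finset.sum_congr rfl fun i _ => ?_
    have h := hX.2 0 fun _ => i
    simp only [Finset.range_zero, Finset.prod_empty, mul_one] at h
    rw [← h]
    congr 2
    ext ω
    simp
  | succ n ih =>
    rw [Function.iterate_succ_apply, ← ih]
    have hps : ∀ ω, partialSum X (n + 1) ω = partialSum X n ω + X (n + 1) ω := fun ω =>
      Finset.sum_range_succ _ _
    simp only [hps]
    rw [hX.integral_succ n (A := fun ω j => (∏ k ∈ Finset.range (n + 1),
      f (X k ω) (partialSum X k ω)) * u j (partialSum X n ω + j))]
    · refine integral_congr_ae (Eventually.of_forall fun ω => ?_)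
      simp only [weightedOp, walkOp_apply, Finset.prod_range_succ, Finset.mul_sum]
      exact Finset.sum_congr rfl fun j _ => by ring
    · intro ω ω' h
      ext j
      rw [partialSum_congr le_rfl h]
      congr 1
      refine Finset.prod_congr rfl fun k hk => ?_
      have hk' := Nat.le_of_lt_succ (Finset.mem_range.1 hk)
      rw [partialSum_congr hk' h, h k hk']

theorem IsMarkovChain.integral_levelInd [IsFiniteMeasure ℙ] (hX : IsMarkovChain ℙ S P μ X)
    (x : ℤ) (k : ℕ) : ∫ ω, (if partialSum X k ω = x then (1 : ℝ) else 0) ∂ℙ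
      = ∑ i : S, μ i * (walkOp P ^ k) (levelInd S x) i i := by
  have h := hX.integral_prod_mul (fun _ _ => 1) k (levelInd S x)
  have hw : weightedOp P (fun _ _ => 1) = walkOp P := by
    ext u i z
    simp [weightedOp]
  rw [hw] at h
  simpa [levelInd, Module.End.pow_apply] using h

theorem IsMarkovChain.integral_visitCount [IsFiniteMeasure ℙ] (hX : IsMarkovChain ℙ S P μ X)
    (n : ℕ) (x : ℤ) : ∫ ω, (visitCount X n x ω : ℝ) ∂ℙ
      = ∑ i : S, μ i * greenOp P (n + 1) (levelInd S x) i i := by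
  simp only [visitCount_eq_sum]
  rw [integral_finsetSum]
  · simp only [hX.integral_levelInd, greenOp_apply, Finset.mul_sum]
    rw [Finset.sum_comm]
  · intro k _
    refine hX.integrable_of_path (n := k) fun ω ω' h => ?_
    rw [partialSum_congr le_rfl h]

theorem IsMarkovChain.integral_exp_visitCount_sub [IsFiniteMeasure ℙ]
    (hX : IsMarkovChain ℙ S P μ X) (n : ℕ) (x y : ℤ) (θ : ℝ) :
    ∫ ω, Real.exp (θ * ((visitCount X n x ω : ℝ) - visitCount X n y ω)) ∂ℙ
      = ∑ i : S, μ i * (weightedOp P fun i z =>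
          Real.exp (θ * (levelInd S x - levelInd S y) i z))^[n + 1] 1 i i := by
  rw [← hX.integral_prod_mul]
  refine integral_congr_ae (Eventually.of_forall fun ω => ?_)
  simp only [Pi.one_apply, mul_one, visitCount_eq_sum]
  rw [← Real.exp_sum, ← Finset.mul_sum, ← Finset.sum_sub_distrib]
  simp [levelInd]

/-- The expected number of visits to a level is `O(√n)`. -/
theorem IsMarkovChain.exists_integral_visitCount_le [IsFiniteMeasure ℙ]
    (hX : IsMarkovChain ℙ S P μ X) (hP : P ∈ Matrix.rowStochastic ℝ S)
    (hμ : μ ∈ stdSimplex ℝ S) (h : HarmonicCorrector P)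
    (hr : ∀ (i j : S) (z : ℤ), Reaches P i z j) : ∃ C : ℝ, 0 ≤ C ∧
      ∀ (n : ℕ) (x : ℤ), 1 ≤ n → ∫ ω, (visitCount X n x ω : ℝ) ∂ℙ ≤ C * √n := by
  obtain ⟨C, hC, hCle⟩ := h.exists_greenOp_levelInd_le hP hr
  refine ⟨C * 2, by positivity, fun n x hn => ?_⟩
  rw [hX.integral_visitCount]
  have hn' : (1 : ℝ) ≤ n := by exact_mod_cast hn
  have hs : √((n + 1 : ℕ) : ℝ) ≤ 2 * √n := by
    rw [Real.sqrt_le_iff]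
    refine ⟨by positivity, ?_⟩
    rw [mul_pow, Real.sq_sqrt (by linarith)]
    push_cast
    linarith
  calc ∑ i : S, μ i * greenOp P (n + 1) (levelInd S x) i i
      ≤ ∑ i : S, μ i * (C * 2 * √n) := Finset.sum_le_sum fun i _ =>
        mul_le_mul_of_nonneg_left ((hCle _ x i i).trans (by
          have := mul_le_mul_of_nonneg_left hs hC
          linarith)) (hμ.1 i)
    _ = C * 2 * √n := by rw [← Finset.sum_mul, hμ.2, one_mul]

/-- Tail estimate for differences of visit counts, as from the fourth moment. -/
theorem IsMarkovChain.exists_real_visitCount_sub_le [IsFiniteMeasure ℙ]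
    (hX : IsMarkovChain ℙ S P μ X) (hP : P ∈ Matrix.rowStochastic ℝ S)
    (hμ : μ ∈ stdSimplex ℝ S) (h : HarmonicCorrector P)
    (hr : ∀ (i j : S) (z : ℤ), Reaches P i z j) : ∃ C : ℝ, 0 ≤ C ∧
      ∀ (n : ℕ) (x y : ℤ) (l : ℝ), 1 ≤ n → x ≠ y → (x - y) ^ 2 ≤ n → 0 < l →
        ℙ.real {ω | l ≤ |(visitCount X n x ω : ℝ) - visitCount X n y ω|}
          ≤ C * (((x : ℝ) - y) ^ 2 * n) / l ^ 4 := by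
  obtain ⟨C, hC, hCle⟩ := h.exists_iterate_weightedOp_le hP hr
  refine ⟨96 * C, by positivity, fun n x y l hn hxy hxyn hl => ?_⟩
  obtain ⟨θ, hθ, hθC, hexp⟩ := hCle n x y hn hxy hxyn
  set A : Ω → ℝ := fun ω => (visitCount X n x ω : ℝ) - visitCount X n y ω with hA
  have hint : ∀ c : ℝ, Integrable (fun ω => Real.exp (c * A ω)) ℙ := fun c =>
    hX.integrable_of_path (n := n) fun ω ω' hω => by
      simp only [hA, visitCount_congr hω]
  have hsum2 : ∀ g : S → ℝ, (∀ i, g i ≤ 2) → ∑ i, μ i * g i ≤ 2 := fun g hg =>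
    calc ∑ i, μ i * g i ≤ ∑ i, μ i * 2 := Finset.sum_le_sum fun i _ =>
          mul_le_mul_of_nonneg_left (hg i) (hμ.1 i)
      _ = 2 := by rw [← Finset.sum_mul, hμ.2, one_mul]
  have h1 : ∫ ω, Real.exp (θ * A ω) ∂ℙ ≤ 2 := by
    rw [hX.integral_exp_visitCount_sub n x y θ]
    exact hsum2 _ fun i => (hexp i i).1
  have h2 : ∫ ω, Real.exp (-θ * A ω) ∂ℙ ≤ 2 := by
    have : ∀ ω, -θ * A ω = θ * ((visitCount X n y ω : ℝ) - visitCount X n x ω) := fun ω => by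
      simp only [hA]; ring
    simp only [this]
    rw [hX.integral_exp_visitCount_sub n y x θ]
    exact hsum2 _ fun i => (hexp i i).2
  have h3 : ∫ ω, (Real.exp (θ * A ω) + Real.exp (-θ * A ω)) ∂ℙ ≤ 4 := by
    rw [integral_add (hint _) (hint _)]
    linarith
  have h4 := mul_meas_ge_le_integral_of_nonneg (μ := ℙ)
    (f := fun ω => Real.exp (θ * A ω) + Real.exp (-θ * A ω))
    (Eventually.of_forall fun ω => by simp only [Pi.zero_apply]; positivity)
    ((hint θ).add (hint (-θ))) ((θ * l) ^ 4 / 24)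
  -- From t⁴/4! ≤ e^t with t = θ|A|; together with the two exponential moments this yields the
  -- constant 96 = 4 · 24.
  have h5 : {ω | l ≤ |A ω|}
      ⊆ {ω | (θ * l) ^ 4 / 24 ≤ Real.exp (θ * A ω) + Real.exp (-θ * A ω)} := fun ω hω => by
    have hω' : l ≤ |A ω| := hω
    have h6 := Real.pow_div_factorial_le_exp (θ * |A ω|) (by positivity) 4
    have h7 : (θ * l) ^ 4 ≤ (θ * |A ω|) ^ 4 := by gcongr
    have h8 : Real.exp (θ * |A ω|) ≤ Real.exp (θ * A ω) + Real.exp (-θ * A ω) := by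
      rcases abs_choice (A ω) with ha | ha <;> rw [ha]
      · linarith [Real.exp_pos (-θ * A ω)]
      · rw [mul_neg, ← neg_mul]
        linarith [Real.exp_pos (θ * A ω)]
    have h9 : ((Nat.factorial 4 : ℕ) : ℝ) = 24 := by norm_num [Nat.factorial]
    rw [h9] at h6
    change (θ * l) ^ 4 / 24 ≤ _
    linarith
  have h6 := measureReal_mono (μ := ℙ) h5
  have h7 : (θ * l) ^ 4 / 24 * ℙ.real {ω | l ≤ |A ω|} ≤ 4 :=
    (mul_le_mul_of_nonneg_left h6 (by positivity)).trans (h4.trans h3)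
  rw [le_div_iff₀ (by positivity)]
  set p := ℙ.real {ω | l ≤ |A ω|}
  set V := ((x : ℝ) - y) ^ 2 * n
  have hV : 0 ≤ V := by positivity
  have h8 : θ ^ 4 * (p * l ^ 4) ≤ 96 := by
    have : (θ * l) ^ 4 / 24 * p = θ ^ 4 * (p * l ^ 4) / 24 := by ring
    linarith
  have hpl : 0 ≤ p * l ^ 4 := mul_nonneg measureReal_nonneg (by positivity)
  -- The lower bound on θ⁴ V trades θ⁻⁴ for V = (x-y)² n.
  calc p * l ^ 4 ≤ (C * θ ^ 4 * V) * (p * l ^ 4) := le_mul_of_one_le_left hpl hθC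
    _ = C * V * (θ ^ 4 * (p * l ^ 4)) := by ring
    _ ≤ C * V * 96 := mul_le_mul_of_nonneg_left h8 (by positivity)
    _ = 96 * C * V := by ring

end MarkovChain

/-! ### Dyadic chaining -/

/-- Bounds for the dyadic increments of `g : ℤ → ℝ` of size `2 ^ K, 2 ^ (K - 1), …, 1` in the
window `[-R 2 ^ K, R 2 ^ K]`. -/
structure DyadicBound (g : ℤ → ℝ) (K R : ℕ) (M : ℝ) : Prop where
  incr_le : ∀ j ≤ K, ∀ i : ℤ, |i| ≤ R * 2 ^ j →
    |g ((i + 1) * 2 ^ (K - j)) - g (i * 2 ^ (K - j))| ≤ M * (9 / 10) ^ j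
  abs_le : ∀ i : ℤ, |i| ≤ R → |g (i * 2 ^ K)| ≤ M

namespace DyadicBound

variable {g : ℤ → ℝ} {K R : ℕ} {M : ℝ}

theorem abs_ediv_le {x : ℤ} {l : ℕ} (hl : l ≤ K) (hx : |x| ≤ R * 2 ^ K) :
    |x / 2 ^ l| ≤ R * 2 ^ (K - l) := by
  have h2 : (0 : ℤ) < 2 ^ l := by positivity
  have hK : (2 : ℤ) ^ K = 2 ^ (K - l) * 2 ^ l := by rw [← pow_add, Nat.sub_add_cancel hl]
  rw [hK, ← mul_assoc] at hx
  obtain ⟨h3, h4⟩ := _root_.abs_le.1 hx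
  rw [_root_.abs_le]
  constructor
  · rw [Int.le_ediv_iff_mul_le h2]
    linarith
  · have := Int.ediv_le_ediv h2 h4
    rwa [Int.mul_ediv_cancel _ h2.ne'] at this

/-- Climbing the dyadic floors of x from scale 1 to scale 2^l costs one increment per level. The
constant 9 solves a = (9/10)(a + 1). The window has one unit to spare because passing to an even
index may move it left by one. -/
theorem abs_sub_floor_le (h : DyadicBound g K (R + 1) M) {x : ℤ} (hx : |x| ≤ R * 2 ^ K)
    {l : ℕ} (hl : l ≤ K) : |g x - g (x / 2 ^ l * 2 ^ l)| ≤ 9 * M * (9 / 10) ^ (K - l) := by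
  have hM : 0 ≤ M := (abs_nonneg _).trans (h.abs_le 0 (by simp; positivity))
  induction l with
  | zero => simpa using by positivity
  | succ l ih =>
    have hl' : l ≤ K := by omega
    have h1 := ih hl'
    have hp : (2 : ℤ) ^ (l + 1) = 2 ^ l * 2 := pow_succ 2 l
    have hdiv : x / 2 ^ (l + 1) = x / 2 ^ l / 2 := by
      rw [hp, Int.ediv_ediv_of_nonneg (by positivity)]
    have h2 := abs_ediv_le hl' hx
    set y := x / 2 ^ l with hy
    have hone : (1 : ℤ) ≤ 2 ^ (K - l) := one_le_pow₀ (by norm_num)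
    have h3 : |g (y * 2 ^ l) - g (x / 2 ^ (l + 1) * 2 ^ (l + 1))| ≤ M * (9 / 10) ^ (K - l) := by
      rw [hdiv, hp]
      rcases Int.emod_two_eq_zero_or_one y with hmod | hmod
      · have : y / 2 * (2 ^ l * 2) = y * 2 ^ l := by
          have : y = 2 * (y / 2) := by omega
          nth_rw 2 [this]
          ring
        rw [this, sub_self, abs_zero]
        positivity
      · have h4 : y / 2 * (2 ^ l * 2) = (2 * (y / 2)) * 2 ^ l := by ring
        have h5 : y = 2 * (y / 2) + 1 := by omega
        have h6 := h.incr_le (K - l) (Nat.sub_le _ _) (2 * (y / 2)) (by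
          have h7 : 2 * (y / 2) = y - 1 := by omega
          rw [h7]
          obtain ⟨h8, h9⟩ := _root_.abs_le.1 h2
          push_cast
          rw [_root_.abs_le]
          constructor <;> nlinarith)
        rw [Nat.sub_sub_self hl', ← h5] at h6
        rwa [h4]
    have h4 : g x - g (x / 2 ^ (l + 1) * 2 ^ (l + 1))
        = (g x - g (y * 2 ^ l)) + (g (y * 2 ^ l) - g (x / 2 ^ (l + 1) * 2 ^ (l + 1))) := by ring
    have h5 : (9 / 10 : ℝ) ^ (K - l) = (9 / 10) ^ (K - (l + 1)) * (9 / 10) := by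
      rw [← pow_succ]
      congr 1
      omega
    rw [h4]
    refine (abs_add_le _ _).trans ((add_le_add h1 h3).trans (le_of_eq ?_))
    rw [h5]
    ring

theorem abs_apply_le (h : DyadicBound g K (R + 1) M) {x : ℤ} (hx : |x| ≤ R * 2 ^ K) :
    |g x| ≤ 10 * M := by
  have h1 := h.abs_sub_floor_le hx le_rfl
  have h2 := abs_ediv_le le_rfl hx
  rw [Nat.sub_self, pow_zero, mul_one] at h1 h2
  have h3 := h.abs_le (x / 2 ^ K) (h2.trans (by push_cast; linarith))
  have h4 := abs_add_le (g x - g (x / 2 ^ K * 2 ^ K)) (g (x / 2 ^ K * 2 ^ K))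
  rw [sub_add_cancel] at h4
  linarith

theorem abs_sub_le (h : DyadicBound g K (R + 1) M) {x y : ℤ} (hx : |x| ≤ R * 2 ^ K)
    (hy : |y| ≤ R * 2 ^ K) {j : ℕ} (hj : j ≤ K) (hxy : |x - y| ≤ 2 ^ (K - j)) :
    |g x - g y| ≤ 19 * M * (9 / 10) ^ j := by
  wlog hle : y ≤ x generalizing x y
  · rw [abs_sub_comm]
    exact this hy hx (by rwa [abs_sub_comm]) (by omega)
  have hM : 0 ≤ M := (abs_nonneg _).trans (h.abs_le 0 (by simp; positivity))
  have hl : K - j ≤ K := Nat.sub_le _ _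
  have h1 := h.abs_sub_floor_le hx hl
  have h2 := h.abs_sub_floor_le hy hl
  have h3 := abs_ediv_le hl hy
  have hKj := Nat.sub_sub_self hj
  rw [hKj] at h1 h2 h3
  set q : ℤ := 2 ^ (K - j) with hq
  have hq0 : 0 < q := by positivity
  -- At scale q the floors coincide or are adjacent, so the total cost is 9 + 9 + 1 = 19.
  have hfloor : x / q = y / q ∨ x / q = y / q + 1 := by
    rw [abs_of_nonneg (by omega)] at hxy
    have h4 := Int.ediv_le_ediv hq0 hle
    have h5 := Int.ediv_le_ediv hq0 (show x ≤ y + 1 * q by linarith)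
    rw [Int.add_mul_ediv_right _ _ hq0.ne'] at h5
    omega
  have h6 : |g (x / q * q) - g (y / q * q)| ≤ M * (9 / 10) ^ j := by
    rcases hfloor with he | he
    · rw [he, sub_self, abs_zero]
      positivity
    · rw [he]
      refine h.incr_le j hj (y / q) (h3.trans ?_)
      have : (0 : ℤ) < 2 ^ j := by positivity
      push_cast
      nlinarith
  have h7 : g x - g y = (g x - g (x / q * q)) + (g (x / q * q) - g (y / q * q))
      - (g y - g (y / q * q)) := by ring
  rw [h7]
  have h8 := abs_sub ((g x - g (x / q * q)) + (g (x / q * q) - g (y / q * q)))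
    (g y - g (y / q * q))
  have h9 := abs_add_le (g x - g (x / q * q)) (g (x / q * q) - g (y / q * q))
  linarith

end DyadicBound

/-! ### Dyadic bounds for the local time -/

section Tightness

variable {Ω : Type*} [MeasurableSpace Ω] {ℙ : Measure Ω} {S : Finset ℤ} {P : Matrix S S ℝ}
  {μ : S → ℝ} {X : ℕ → Ω → S}

/-- The dyadic increments of the local time are tight on the Brownian scale. -/
theorem IsMarkovChain.exists_real_not_dyadicBound_le [IsProbabilityMeasure ℙ]
    (hX : IsMarkovChain ℙ S P μ X) (hP : P ∈ Matrix.rowStochastic ℝ S)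
    (hμ : μ ∈ stdSimplex ℝ S) (h : HarmonicCorrector P)
    (hr : ∀ (i j : S) (z : ℤ), Reaches P i z j) (R : ℕ) {ε : ℝ} (hε : 0 < ε) :
    ∃ M : ℝ, 0 ≤ M ∧ ∀ n : ℕ, 1 ≤ n → ℙ.real {ω | ¬ DyadicBound
      (fun x => (visitCount X n x ω : ℝ)) (Nat.log 4 n) R (M * √n)} ≤ ε := by
  obtain ⟨C₁, hC₁, h₁⟩ := hX.exists_integral_visitCount_le hP hμ h hr
  obtain ⟨C₂, hC₂, h₂⟩ := hX.exists_real_visitCount_sub_le hP hμ h hr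
  set B : ℝ := (2 * R + 1) * (5 * C₂ + C₁) with hB
  have hB0 : 0 ≤ B := by positivity
  set M : ℝ := B / ε + 1 with hM
  have hM1 : 1 ≤ M := by
    have : 0 ≤ B / ε := by positivity
    linarith
  have hM0 : 0 < M := by linarith
  refine ⟨M, hM0.le, fun n hn => ?_⟩
  have hn' : (1 : ℝ) ≤ n := by exact_mod_cast hn
  set K := Nat.log 4 n with hK
  have hKn : 4 ^ K ≤ n := Nat.pow_log_le_self 4 (by omega)
  have hKn' : (4 : ℝ) ^ K ≤ n := by exact_mod_cast hKn
  set s : ℝ := √n with hs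
  have hs0 : 0 < s := Real.sqrt_pos.2 (by linarith)
  have hs2 : s ^ 2 = n := Real.sq_sqrt (by linarith)
  set E : ℕ → ℤ → Set Ω := fun j i => {ω | M * s * (9 / 10) ^ j
    ≤ |(visitCount X n ((i + 1) * 2 ^ (K - j)) ω : ℝ) - visitCount X n (i * 2 ^ (K - j)) ω|}
    with hE
  set E' : ℤ → Set Ω := fun i => {ω | M * s ≤ (visitCount X n (i * 2 ^ K) ω : ℝ)} with hE'
  set I : ℕ → Finset ℤ := fun j => Finset.Icc (-(R * 2 ^ j : ℤ)) (R * 2 ^ j) with hI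
  have hcard : ∀ j, ((I j).card : ℝ) ≤ (2 * R + 1) * 2 ^ j := fun j => by
    have h1 : (I j).card = 2 * (R * 2 ^ j) + 1 := by
      rw [hI, Int.card_Icc]
      have h0 : (R * 2 ^ j : ℤ) = ((R * 2 ^ j : ℕ) : ℤ) := by push_cast; ring
      rw [h0]
      omega
    rw [h1]
    have : (1 : ℝ) ≤ 2 ^ j := one_le_pow₀ (by norm_num)
    push_cast
    linarith
  have hsub : {ω | ¬ DyadicBound (fun x => (visitCount X n x ω : ℝ)) K R (M * s)}
      ⊆ (⋃ j ∈ Finset.range (K + 1), ⋃ i ∈ I j, E j i) ∪ ⋃ i ∈ I 0, E' i := by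
    intro ω hω
    by_contra hcon
    simp only [Set.mem_union, Set.mem_iUnion, not_or, not_exists, hE, hE',
      hI, Finset.mem_Icc, ← _root_.abs_le, Finset.mem_range] at hcon
    refine hω ⟨fun j hj i hi => ?_, fun i hi => ?_⟩
    · exact (not_le.1 (hcon.1 j (Nat.lt_succ_of_le hj) i hi)).le
    · rw [abs_of_nonneg (Nat.cast_nonneg _)]
      exact (not_le.1 (hcon.2 i (by simpa using hi))).le
  -- The increment d = 2^(K-j) satisfies d² ≤ n 4^(-j). The tail bound gives M⁻⁴ in front, weakened
  -- to M⁻¹ using M ≥ 1.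
  have hE1 : ∀ j ∈ Finset.range (K + 1), ∀ i ∈ I j, ℙ.real (E j i)
      ≤ C₂ / M * (1 / (4 * (9 / 10) ^ 4)) ^ j := fun j hj i _ => by
    have hjK : j ≤ K := Nat.le_of_lt_succ (Finset.mem_range.1 hj)
    set d : ℤ := 2 ^ (K - j) with hd
    have hd0 : 0 < d := by positivity
    have hdiff : (i + 1) * d - i * d = d := by ring
    have hd2 : d ^ 2 * 4 ^ j = 4 ^ K := by
      rw [hd, ← pow_mul, mul_comm (K - j), pow_mul, show (2 : ℤ) ^ 2 = 4 by norm_num, ← pow_add,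
        Nat.sub_add_cancel hjK]
    have hd2' : (d : ℝ) ^ 2 * 4 ^ j = 4 ^ K := by exact_mod_cast hd2
    have h1 := h₂ n ((i + 1) * d) (i * d) (M * s * (9 / 10) ^ j) hn
      (fun he => hd0.ne' (by linarith)) (by
        rw [hdiff]
        have h4 : (1 : ℤ) ≤ 4 ^ j := one_le_pow₀ (by norm_num)
        have h5 : (4 : ℤ) ^ K ≤ n := by exact_mod_cast hKn
        nlinarith [sq_nonneg d]) (by positivity)
    refine h1.trans ?_
    have hdiff' : ((((i + 1) * d : ℤ) : ℝ) - ((i * d : ℤ) : ℝ)) = d := by push_cast; ring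
    rw [hdiff', div_le_iff₀ (by positivity)]
    have h6 : C₂ / M * (1 / (4 * (9 / 10) ^ 4)) ^ j * (M * s * (9 / 10) ^ j) ^ 4
        = C₂ * M ^ 3 * (s ^ 2) ^ 2 * (1 / 4) ^ j := by
      rw [one_div, inv_pow, mul_pow, ← pow_mul, mul_pow, mul_pow, ← pow_mul, mul_comm 4 j, one_div,
        inv_pow]
      field_simp
    rw [h6, hs2]
    have h7 : (d : ℝ) ^ 2 ≤ n * (1 / 4) ^ j := by
      rw [one_div, inv_pow, ← div_eq_mul_inv, le_div_iff₀ (by positivity), hd2']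
      exact hKn'
    have h8 : (1 : ℝ) ≤ M ^ 3 := one_le_pow₀ hM1
    calc C₂ * ((d : ℝ) ^ 2 * n) ≤ C₂ * ((n * (1 / 4) ^ j) * n) := by gcongr
      _ ≤ M ^ 3 * (C₂ * ((n * (1 / 4) ^ j) * n)) := le_mul_of_one_le_left (by positivity) h8
      _ = _ := by ring
  have hE2 : ∀ i ∈ I 0, ℙ.real (E' i) ≤ C₁ / M := fun i _ => by
    have h1 := mul_meas_ge_le_integral_of_nonneg (μ := ℙ)
      (f := fun ω => (visitCount X n (i * 2 ^ K) ω : ℝ))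
      (Eventually.of_forall fun ω => Nat.cast_nonneg _)
      (hX.integrable_of_path (n := n) fun ω ω' hω => by rw [visitCount_congr hω]) (M * s)
    have h2 := h1.trans (h₁ n (i * 2 ^ K) hn)
    rw [le_div_iff₀ hM0]
    have h3 : s * (ℙ.real (E' i) * M) ≤ s * C₁ := by
      calc s * (ℙ.real (E' i) * M) = M * s * ℙ.real (E' i) := by ring
        _ ≤ C₁ * s := h2
        _ = s * C₁ := mul_comm _ _
    exact le_of_mul_le_mul_left h3 hs0
  -- There are about 2^j increments at level j, so the ratio is 1/(2 (9/10)⁴) < 1; the decay rate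
  -- 9/10 is chosen close enough to 1 for this.
  have hgeo : ∑ j ∈ Finset.range (K + 1), ((1 / (2 * (9 / 10) ^ 4) : ℝ)) ^ j ≤ 5 := by
    have h0 : (0 : ℝ) ≤ 1 / (2 * (9 / 10) ^ 4) := by norm_num
    have h1 : (1 / (2 * (9 / 10) ^ 4) : ℝ) < 1 := by norm_num
    refine ((summable_geometric_of_lt_one h0 h1).sum_le_tsum _
      fun j _ => pow_nonneg h0 j).trans ?_
    rw [tsum_geometric_of_lt_one h0 h1]
    norm_num
  have hb : 0 ≤ C₂ / M := by positivity
  have hb' : 0 ≤ C₁ / M := by positivity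
  have hR : (0 : ℝ) ≤ 2 * R + 1 := by positivity
  have hsum1 : ∑ j ∈ Finset.range (K + 1), ∑ i ∈ I j, ℙ.real (E j i)
      ≤ (2 * R + 1) * (C₂ / M) * 5 := by
    calc ∑ j ∈ Finset.range (K + 1), ∑ i ∈ I j, ℙ.real (E j i)
        ≤ ∑ j ∈ Finset.range (K + 1), (2 * R + 1) * (C₂ / M)
            * ((1 / (2 * (9 / 10) ^ 4) : ℝ)) ^ j := Finset.sum_le_sum fun j hj => by
          refine (Finset.sum_le_sum (hE1 j hj)).trans ?_
          rw [Finset.sum_const, nsmul_eq_mul]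
          refine (mul_le_mul_of_nonneg_right (hcard j) (by positivity)).trans (le_of_eq ?_)
          have : (1 / (2 * (9 / 10) ^ 4) : ℝ) ^ j = 2 ^ j * (1 / (4 * (9 / 10) ^ 4)) ^ j := by
            rw [← mul_pow]; norm_num
          rw [this]
          ring
      _ ≤ _ := by
          rw [← Finset.mul_sum]
          exact mul_le_mul_of_nonneg_left hgeo (by positivity)
  have hsum2 : ∑ i ∈ I 0, ℙ.real (E' i) ≤ (2 * R + 1) * (C₁ / M) := by
    refine (Finset.sum_le_sum hE2).trans ?_
    rw [Finset.sum_const, nsmul_eq_mul]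
    refine mul_le_mul_of_nonneg_right ?_ hb'
    simpa using hcard 0
  calc ℙ.real {ω | ¬ DyadicBound (fun x => (visitCount X n x ω : ℝ)) K R (M * s)}
      ≤ ℙ.real ((⋃ j ∈ Finset.range (K + 1), ⋃ i ∈ I j, E j i) ∪ ⋃ i ∈ I 0, E' i) :=
        measureReal_mono hsub
    _ ≤ ℙ.real (⋃ j ∈ Finset.range (K + 1), ⋃ i ∈ I j, E j i) + ℙ.real (⋃ i ∈ I 0, E' i) :=
        measureReal_union_le _ _
    _ ≤ ∑ j ∈ Finset.range (K + 1), ∑ i ∈ I j, ℙ.real (E j i) + ∑ i ∈ I 0, ℙ.real (E' i) :=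
        add_le_add ((measureReal_biUnion_finset_le _ _).trans
          (Finset.sum_le_sum fun j _ => measureReal_biUnion_finset_le _ _))
          (measureReal_biUnion_finset_le _ _)
    _ ≤ (2 * R + 1) * (C₂ / M) * 5 + (2 * R + 1) * (C₁ / M) := add_le_add hsum1 hsum2
    _ = B / M := by rw [hB]; ring
    _ ≤ ε := by
        rw [div_le_iff₀ hM0, hM, mul_add, mul_div_cancel₀ _ hε.ne']
        linarith

end Tightness

/-- The oscillation of the rescaled local time under a dyadic bound. -/
theorem DyadicBound.localTime_bounds {Ω : Type*} {S : Finset ℤ} {X : ℕ → Ω → S} {n m : ℕ} (hn : 1 ≤ n) {M : ℝ} {ω : Ω}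
    (h : DyadicBound (fun x => (visitCount X n x ω : ℝ)) (Nat.log 4 n) (2 * m + 2) (M * √n)) :
    (∀ x : ℝ, |x| ≤ m → |localTime X n ω x| ≤ 10 * M) ∧
      ∀ j : ℕ, 4 ^ j ≤ n → ∀ x y : ℝ, |x| ≤ m → |y| ≤ m → |x - y| ≤ 1 / 2 ^ (j + 1) →
        |localTime X n ω x - localTime X n ω y| ≤ 19 * M * (9 / 10) ^ j := by
  have hn' : (1 : ℝ) ≤ n := by exact_mod_cast hn
  set K := Nat.log 4 n with hK
  set s : ℝ := √n with hs
  have hs0 : 0 < s := Real.sqrt_pos.2 (by linarith)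
  have hsK : s < 2 ^ (K + 1) := by
    rw [hs, Real.sqrt_lt' (by positivity), ← pow_mul, mul_comm, pow_mul]
    have := Nat.lt_pow_succ_log_self (b := 4) (by norm_num) n
    norm_num
    exact_mod_cast this
  -- As √n < 2^(K+1), the rescaled window has radius at most 2m units of 2^K. The dyadic bound is
  -- assumed with 2m + 2, leaving the spare unit that chaining needs.
  have hfl : ∀ x : ℝ, |x| ≤ m → |⌊s * x⌋| ≤ ((2 * m + 1 : ℕ) : ℤ) * 2 ^ K := fun x hx => by
    have h1 : |s * x| ≤ 2 ^ (K + 1) * m := by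
      rw [abs_mul, abs_of_pos hs0]
      exact mul_le_mul hsK.le hx (abs_nonneg _) (by positivity)
    obtain ⟨h2, h3⟩ := _root_.abs_le.1 h1
    have hone : (1 : ℤ) ≤ 2 ^ K := one_le_pow₀ (by norm_num)
    have hp : (2 : ℤ) ^ (K + 1) * m = 2 * m * 2 ^ K := by ring
    have h4 : -((2 : ℤ) ^ (K + 1) * m) ≤ ⌊s * x⌋ := by
      rw [Int.le_floor]
      push_cast
      exact h2
    have h5 : ⌊s * x⌋ ≤ (2 : ℤ) ^ (K + 1) * m := by
      have : (⌊s * x⌋ : ℝ) ≤ ((2 ^ (K + 1) * m : ℤ) : ℝ) := by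
        push_cast
        exact (Int.floor_le _).trans h3
      exact_mod_cast this
    push_cast
    rw [_root_.abs_le]
    constructor <;> linarith
  constructor
  · intro x hx
    rw [localTime, abs_div, abs_of_pos hs0, div_le_iff₀ hs0]
    have := h.abs_apply_le (hfl x hx)
    linarith
  · intro j hj x y hx hy hxy
    have hjK : j ≤ K := Nat.le_log_of_pow_le (by norm_num) hj
    have hd : |⌊s * x⌋ - ⌊s * y⌋| ≤ 2 ^ (K - j) := by
      -- Strictness matters: taking floors can enlarge the difference by less than 1, and
      -- integrality then restores the bound 2^(K-j).
      have h1 : |s * x - s * y| < 2 ^ (K - j) := by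
        rw [← mul_sub, abs_mul, abs_of_pos hs0]
        have h2 : (2 : ℝ) ^ (K + 1) * (1 / 2 ^ (j + 1)) = 2 ^ (K - j) := by
          rw [mul_one_div, div_eq_iff (by positivity), ← pow_add]
          congr 1
          omega
        rw [← h2]
        calc s * |x - y| ≤ s * (1 / 2 ^ (j + 1)) := mul_le_mul_of_nonneg_left hxy hs0.le
          _ < _ := mul_lt_mul_of_pos_right hsK (by positivity)
      obtain ⟨h2, h3⟩ := abs_lt.1 h1
      have h4 := Int.floor_le (s * x)
      have h5 := Int.lt_floor_add_one (s * x)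
      have h6 := Int.floor_le (s * y)
      have h7 := Int.lt_floor_add_one (s * y)
      have h8 : ((⌊s * x⌋ - ⌊s * y⌋ : ℤ) : ℝ) < ((2 ^ (K - j) + 1 : ℤ) : ℝ) := by
        push_cast; linarith
      have h9 : ((-(2 ^ (K - j) + 1) : ℤ) : ℝ) < ((⌊s * x⌋ - ⌊s * y⌋ : ℤ) : ℝ) := by
        push_cast; linarith
      have h8' : ⌊s * x⌋ - ⌊s * y⌋ < 2 ^ (K - j) + 1 := by exact_mod_cast h8
      have h9' : -(2 ^ (K - j) + 1) < ⌊s * x⌋ - ⌊s * y⌋ := by exact_mod_cast h9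
      rw [_root_.abs_le]
      constructor <;> linarith
    rw [localTime, localTime, ← sub_div, abs_div, abs_of_pos hs0, div_le_iff₀ hs0]
    have := h.abs_sub_le (hfl x hx) (hfl y hy) hjK hd
    linarith

/-! ### Compact sets in the Skorokhod space -/

namespace SkorokhodD

/-- By right continuity two functions differing at a stay apart on an interval [a, a + η). Time
changes by at most η/8 keep its midpoint inside, so no function is close to both. Separation makes
compact sets closed, hence Borel. -/
instance : T2Space SkorokhodD := by
  refine t2Space_iff_disjoint_nhds.2 fun f g hfg => ?_
  obtain ⟨a, ha⟩ : ∃ a, f a ≠ g a := by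
    by_contra! hcon
    cases f
    cases g
    exact hfg (by congr; exact funext hcon)
  set δ : ℝ := |f a - g a| with hδ
  have hδ0 : 0 < δ := abs_pos.2 (sub_ne_zero.2 ha)
  have hnear : ∀ k : SkorokhodD, ∃ η > 0, ∀ t, a ≤ t → t < a + η → |k t - k a| < δ / 8 := by
    intro k
    obtain ⟨η, hη, hk⟩ := Metric.continuousWithinAt_iff.1 (k.cadlag a).1 (δ / 8) (by positivity)
    refine ⟨η, hη, fun t h1 h2 => ?_⟩
    have := hk (Set.mem_Ici.2 h1) (by rw [Real.dist_eq, abs_of_nonneg (by linarith)]; linarith)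
    rwa [Real.dist_eq] at this
  obtain ⟨η₁, hη₁, hf⟩ := hnear f
  obtain ⟨η₂, hη₂, hg⟩ := hnear g
  set η := min η₁ η₂ with hη
  have hη0 : 0 < η := lt_min hη₁ hη₂
  set ε := min (η / 8) (δ / 8) with hε
  have hε0 : 0 < ε := lt_min (by positivity) (by positivity)
  have hεη : ε ≤ η / 8 := min_le_left _ _
  have hεδ : ε ≤ δ / 8 := min_le_right _ _
  set m := |a| + η with hm
  refine Filter.disjoint_iff.2 ⟨f.basicNhd m ε, mem_nhds_iff_basicNhd.2 ⟨m, ε, hε0, subset_rfl⟩,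
    g.basicNhd m ε, mem_nhds_iff_basicNhd.2 ⟨m, ε, hε0, subset_rfl⟩, ?_⟩
  rw [Set.disjoint_left]
  rintro k ⟨lam, hl1, hl2⟩ ⟨kap, hk1, hk2⟩
  set t := a + η / 2 with ht
  set s := kap.symm (lam t) with hs
  have hks : kap s = lam t := kap.apply_symm_apply _
  have h1 := abs_le.1 (hl1 t)
  have h2 := abs_le.1 (hk1 s)
  rw [hks] at h2
  have h3 := le_abs_self a
  have h4 := neg_abs_le a
  have hη1 : η ≤ η₁ := min_le_left _ _
  have hη2 : η ≤ η₂ := min_le_right _ _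
  have h5 := abs_le.1 (hl2 t (abs_le.2 ⟨by linarith, by linarith⟩))
  have h6 := abs_le.1 (hk2 s (abs_le.2 ⟨by linarith, by linarith⟩))
  rw [hks] at h6
  have h7 := abs_lt.1 (hf t (by linarith) (by linarith))
  have h8 := abs_lt.1 (hg s (by linarith) (by linarith))
  have h9 : δ < δ := abs_lt.2 ⟨by linarith, by linarith⟩
  exact lt_irrefl _ h9

/-- An ultrafilter (or filter) of càdlàg functions that converges locally uniformly converges in the
Skorokhod topology. -/
theorem le_nhds_of_locally_uniform {F : Filter SkorokhodD} {g : SkorokhodD}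
    (h : ∀ (m : ℕ) (ε : ℝ), 0 < ε → ∀ᶠ f in F, ∀ t : ℝ, |t| ≤ m → |f t - g t| ≤ ε) :
    F ≤ 𝓝 g := by
  intro A hA
  obtain ⟨m, ε, hε, hsub⟩ := mem_nhds_iff_basicNhd.1 hA
  filter_upwards [h ⌈m⌉₊ ε hε] with f hf
  exact hsub ⟨OrderIso.refl ℝ, fun t => by simpa using hε.le, fun t ht =>
    hf t (ht.trans (Nat.le_ceil m))⟩

/-- The functions bounded by `M m` on `[-m, m]`, for all `m`. -/
def boundedBy (M : ℕ → ℝ) : Set SkorokhodD := {f | ∀ (m : ℕ) (x : ℝ), |x| ≤ m → |f x| ≤ M m}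

/-- The functions that oscillate by at most `ω m` on the subintervals of `[-m, m]` of length
`δ`. -/
def oscillationLe (δ : ℝ) (w : ℕ → ℝ) : Set SkorokhodD :=
  {f | ∀ (m : ℕ) (x y : ℝ), |x| ≤ m → |y| ≤ m → |x - y| ≤ δ → |f x - f y| ≤ w m}

/-- The functions that are constant on the cells of the lattice `c⁻¹ ℤ`. -/
def stepFunctions (c : ℝ) : Set SkorokhodD := {f | ∀ x : ℝ, f x = f (⌊c * x⌋ / c)}

/-- Local boundedness together with a modulus of continuity up to the scale of the lattice
`c n⁻¹ ℤ` on which a function is a step function define a compact set. -/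
theorem isCompact_of_modulus (B : ℕ → ℝ) (c : ℕ → ℝ) (hc : ∀ n, 0 < c n) (J : ℕ → ℕ → Prop)
    (hJ : ∀ j, {n | ¬ J j n}.Finite) (δ : ℕ → ℝ) (hδ : ∀ j, 0 < δ j) (w : ℕ → ℕ → ℝ)
    (hw : ∀ m, Tendsto (fun j => w j m) atTop (𝓝 0)) :
    IsCompact (boundedBy B ∩ ((⋂ j, oscillationLe (δ j) (w j)) ∪
      ⋃ n, stepFunctions (c n) ∩ ⋂ j, ⋂ (_ : J j n), oscillationLe (δ j) (w j))) := by
  rw [isCompact_iff_ultrafilter_le_nhds]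
  intro F hF
  rw [le_principal_iff] at hF
  have hFB : boundedBy B ∈ F := mem_of_superset hF Set.inter_subset_left
  have hlim : ∀ x : ℝ, ∃ l, Tendsto (fun f : SkorokhodD => f x) F (𝓝 l) := fun x => by
    obtain ⟨m, hm⟩ := exists_nat_ge |x|
    have hmem : (fun f : SkorokhodD => f x) ⁻¹' Set.Icc (-B m) (B m) ∈ F := by
      filter_upwards [hFB] with f hf
      exact abs_le.1 (hf m x hm)
    obtain ⟨l, -, hl⟩ := isCompact_Icc.ultrafilter_le_nhds'
      (F.map fun f : SkorokhodD => f x) (Ultrafilter.mem_map.2 hmem)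
    exact ⟨l, hl⟩
  choose g hg using hlim
  have hgB : ∀ (m : ℕ) (x : ℝ), |x| ≤ m → |g x| ≤ B m := fun m x hx =>
    le_of_tendsto (hg x).abs (by filter_upwards [hFB] with f hf using hf m x hx)
  have hgosc : ∀ j, oscillationLe (δ j) (w j) ∈ F → ∀ (m : ℕ) (x y : ℝ), |x| ≤ m → |y| ≤ m →
      |x - y| ≤ δ j → |g x - g y| ≤ w j m := fun j hj m x y hx hy hxy =>
    le_of_tendsto ((hg x).sub (hg y)).abs
      (by filter_upwards [hj] with f hf using hf m x y hx hy hxy)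
  have hfin : ∀ (T : Set ℝ), T.Finite → ∀ ε > 0, ∀ᶠ f : SkorokhodD in F,
      ∀ t ∈ T, |f t - g t| ≤ ε := fun T hT ε hε => by
    refine (eventually_all_finite hT).2 fun t _ => ?_
    have := Metric.tendsto_nhds.1 (hg t) ε hε
    filter_upwards [this] with f hf
    rw [Real.dist_eq] at hf
    exact hf.le
  -- Either one lattice carries the ultrafilter, and the pointwise limit is a step function with
  -- finitely many cells in each window, or none does and the limit is continuous.
  by_cases hcase : ∃ n, stepFunctions (c n) ∩ ⋂ j, ⋂ (_ : J j n), oscillationLe (δ j) (w j) ∈ F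
  · obtain ⟨n, hn⟩ := hcase
    have hstep : stepFunctions (c n) ∈ F := mem_of_superset hn Set.inter_subset_left
    have hgstep : ∀ x, g x = g (⌊c n * x⌋ / c n) := fun x =>
      tendsto_nhds_unique (hg x) ((hg _).congr' (by
        filter_upwards [hstep] with f hf using (hf x).symm))
    have hgcad : CadlagReal g := by
      have := cadlag_comp_floor (fun k => g (k / c n)) (hc n).le
      rwa [← funext hgstep] at this
    refine ⟨⟨g, hgcad⟩, ⟨hgB, Or.inr (Set.mem_iUnion.2 ⟨n, hgstep, ?_⟩)⟩, ?_⟩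
    · simp only [Set.mem_iInter]
      exact fun j hj => hgosc j (mem_of_superset hn (Set.inter_subset_right.trans
        (Set.iInter₂_subset j hj)))
    · refine le_nhds_of_locally_uniform fun m ε hε => ?_
      have h1 := hfin ((fun k : ℤ => (k : ℝ) / c n) '' Set.Icc ⌊-(c n * m)⌋ ⌊c n * m⌋)
        ((Set.finite_Icc _ _).image _) ε hε
      filter_upwards [h1, hstep] with f hf hfs t ht
      rw [hfs t, hgstep t]
      obtain ⟨h2, h3⟩ := abs_le.1 ht
      refine hf _ ⟨⌊c n * t⌋, ⟨Int.floor_mono ?_, Int.floor_mono ?_⟩, rfl⟩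
      · rw [← mul_neg]
        exact mul_le_mul_of_nonneg_left h2 (hc n).le
      · exact mul_le_mul_of_nonneg_left h3 (hc n).le
  -- Only finitely many lattices escape the j-th modulus, and none of them has full ultrafilter
  -- measure, so the modulus itself does.
  · have hosc : ∀ j, oscillationLe (δ j) (w j) ∈ F := fun j => by
      by_contra hj
      have h1 : (⋃ n ∈ {n | ¬ J j n}, stepFunctions (c n) ∩
          ⋂ j, ⋂ (_ : J j n), oscillationLe (δ j) (w j)) ∉ F := by
        rw [Ultrafilter.finite_biUnion_mem_iff (hJ j)]
        rintro ⟨n, -, hn⟩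
        exact hcase ⟨n, hn⟩
      have h2 : oscillationLe (δ j) (w j) ∪ (⋃ n ∈ {n | ¬ J j n}, stepFunctions (c n) ∩
          ⋂ j, ⋂ (_ : J j n), oscillationLe (δ j) (w j)) ∈ F := by
        refine mem_of_superset hF ?_
        rintro f ⟨-, hf | hf⟩
        · exact Or.inl (Set.mem_iInter.1 hf j)
        · obtain ⟨n, hn⟩ := Set.mem_iUnion.1 hf
          by_cases hJn : J j n
          · exact Or.inl (Set.mem_iInter₂.1 hn.2 j hJn)
          · exact Or.inr (Set.mem_biUnion (show n ∈ {n | ¬ J j n} from hJn) hn)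
      rcases Ultrafilter.union_mem_iff.1 h2 with h | h
      · exact hj h
      · exact h1 h
    have hgo := fun j => hgosc j (hosc j)
    have hgcont : Continuous g := by
      rw [Metric.continuous_iff]
      intro b ε hε
      obtain ⟨m, hm⟩ := exists_nat_ge (|b| + 1)
      obtain ⟨j, hj⟩ := ((hw m).eventually (gt_mem_nhds hε)).exists
      refine ⟨min 1 (δ j), lt_min one_pos (hδ j), fun a ha => ?_⟩
      rw [Real.dist_eq] at ha ⊢
      have h1 := abs_sub_abs_le_abs_sub a b
      have h2 := ha.trans_le (min_le_left _ _)
      exact (hgo j m a b (by linarith) (by linarith) (ha.le.trans (min_le_right _ _))).trans_lt hj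
    refine ⟨⟨g, fun x => ⟨hgcont.continuousWithinAt, g x,
      (hgcont.tendsto x).mono_left nhdsWithin_le_nhds⟩⟩,
      ⟨hgB, Or.inl (Set.mem_iInter.2 hgo)⟩, ?_⟩
    refine le_nhds_of_locally_uniform fun m ε hε => ?_
    obtain ⟨j, hj⟩ := ((hw m).eventually (gt_mem_nhds (show 0 < ε / 3 by positivity))).exists
    -- A mesh 1/q below δ_j: pointwise control on the finite grid extends to the window, with ε/3
    -- for each of the two oscillations and for the grid.
    obtain ⟨q, hq⟩ := exists_nat_gt (1 / δ j)
    have hq0 : (0 : ℝ) < q := (one_div_pos.2 (hδ j)).trans hq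
    have h1 := hfin ((fun k : ℤ => (k : ℝ) / q) '' Set.Icc (-(q * m : ℤ)) (q * m))
      ((Set.finite_Icc _ _).image _) (ε / 3) (by positivity)
    filter_upwards [h1, hosc j] with f hf hfo t ht
    obtain ⟨h2, h3⟩ := abs_le.1 ht
    set p : ℝ := (⌊q * t⌋ : ℝ) / q with hp
    have hk1 : -(q * m : ℤ) ≤ ⌊(q : ℝ) * t⌋ := by
      rw [Int.le_floor]
      push_cast
      nlinarith
    have hk2 : ⌊(q : ℝ) * t⌋ ≤ (q * m : ℤ) := by
      have : (⌊(q : ℝ) * t⌋ : ℝ) ≤ ((q * m : ℤ) : ℝ) := by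
        push_cast
        exact (Int.floor_le _).trans (mul_le_mul_of_nonneg_left h3 hq0.le)
      exact_mod_cast this
    have hk1' : -((q : ℝ) * m) ≤ (⌊(q : ℝ) * t⌋ : ℝ) := by exact_mod_cast hk1
    have hk2' : (⌊(q : ℝ) * t⌋ : ℝ) ≤ (q : ℝ) * m := by exact_mod_cast hk2
    have hpm : |p| ≤ m := by
      rw [hp, abs_div, abs_of_pos hq0, div_le_iff₀ hq0, abs_le]
      constructor <;> linarith
    have htp : |t - p| ≤ δ j := by
      have h4 := Int.floor_le ((q : ℝ) * t)
      have h5 := Int.lt_floor_add_one ((q : ℝ) * t)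
      have h6 : t - p = (q * t - ⌊(q : ℝ) * t⌋) / q := by rw [hp]; field_simp
      rw [h6, abs_div, abs_of_pos hq0, abs_of_nonneg (by linarith), div_le_iff₀ hq0]
      have := (div_lt_iff₀ (hδ j)).1 hq
      linarith
    have h4 := hf p ⟨⌊(q : ℝ) * t⌋, ⟨hk1, hk2⟩, rfl⟩
    have h5 := hfo m t p ht hpm htp
    have h6 := hgo j m t p ht hpm htp
    have h7 : f t - g t = (f t - f p) + (f p - g p) - (g t - g p) := by ring
    rw [h7]
    have h8 := abs_sub ((f t - f p) + (f p - g p)) (g t - g p)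
    have h9 := abs_add_le (f t - f p) (f p - g p)
    linarith

end SkorokhodD

/-! ### Tightness of the local time paths -/

section LocalTimePath

variable {Ω : Type*} {S : Finset ℤ} {X : ℕ → Ω → S}

theorem localTimePath_congr {n : ℕ} {ω ω' : Ω} (h : ∀ k ≤ n, X k ω = X k ω') :
    localTimePath X n ω = localTimePath X n ω' := by
  have : localTime X n ω = localTime X n ω' := by
    ext x
    rw [localTime, localTime, visitCount_congr h]
  simp only [localTimePath, this]

theorem localTimePath_mem_stepFunctions {n : ℕ} (hn : 1 ≤ n) (ω : Ω) :
    localTimePath X n ω ∈ SkorokhodD.stepFunctions (√(n : ℝ)) := fun x => by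
  have hs : √(n : ℝ) ≠ 0 := (Real.sqrt_pos.2 (by exact_mod_cast hn)).ne'
  change localTime X n ω x = localTime X n ω _
  rw [localTime, localTime, mul_div_cancel₀ _ hs, Int.floor_intCast]

end LocalTimePath

theorem mainTheorem8
    (S : Finset ℤ) (P : Matrix S S ℝ)
    (hP : P ∈ Matrix.rowStochastic ℝ S)
    (hirr : P.IsIrreducible)
    (hap : StronglyAperiodic S P)
    (ν : S → ℝ) (hν : ν ∈ stdSimplex ℝ S) (hνP : Matrix.vecMul ν P = ν)
    (hmean : ∑ s : S, ν s * ((s : ℤ) : ℝ) = 0)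
    (μ : S → ℝ) (hμ : μ ∈ stdSimplex ℝ S)
    {Ω : Type*} [MeasurableSpace Ω] (ℙ : Measure Ω) [IsProbabilityMeasure ℙ]
    (X : ℕ → Ω → S) (hX : IsMarkovChain ℙ S P μ X) :
    (∀ n : ℕ, Measurable (localTimePath X n)) ∧
      IsTightMeasureSet ((fun n : ℕ => ℙ.map (localTimePath X n)) '' Set.Ici 1) := by
  obtain ⟨ω₀⟩ := nonempty_of_isProbabilityMeasure ℙ
  have : Nonempty SkorokhodD := ⟨localTimePath X 0 ω₀⟩
  have hmeas : ∀ n : ℕ, Measurable (localTimePath X n) := fun n =>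
    hX.measurable_of_path (n := n) fun _ _ h => localTimePath_congr h
  refine ⟨hmeas, ?_⟩
  obtain ⟨h⟩ := nonempty_harmonicCorrector hP hirr hν hνP hmean
  have hr := hap.reaches hP hirr (stationary_pos hP hirr hν hνP) hνP hmean
  rw [isTightMeasureSet_iff_exists_isCompact_measure_compl_le]
  intro ε hε
  -- The failure probability is distributed over the windows [-m, m] with summable weights.
  obtain ⟨ε', hε', hsum⟩ := ENNReal.exists_pos_sum_of_countable hε.ne' ℕ
  choose M _ hM using fun m => hX.exists_real_not_dyadicBound_le hP hμ h hr (2 * m + 2)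
    (NNReal.coe_pos.2 (hε' m))
  -- The lattice index is shifted by one to keep the mesh parameter positive at index 0; t_n thus
  -- uses index n - 1.
  have hcomp := SkorokhodD.isCompact_of_modulus (fun m => 10 * M m)
    (fun n => √((n + 1 : ℕ) : ℝ)) (fun n => Real.sqrt_pos.2 (by positivity))
    (fun j n => 4 ^ j ≤ n + 1)
    (fun j => (Set.finite_Iio (4 ^ j)).subset fun n hn => by
      have : ¬ 4 ^ j ≤ n + 1 := hn
      exact Set.mem_Iio.2 (by omega))
    (fun j => 1 / 2 ^ (j + 1)) (fun j => by positivity) (fun j m => 19 * M m * (9 / 10) ^ j)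
    (fun m => by
      simpa using (tendsto_pow_atTop_nhds_zero_of_lt_one (r := (9 / 10 : ℝ)) (by norm_num)
        (by norm_num)).const_mul (19 * M m))
  refine ⟨_, hcomp, ?_⟩
  rintro _ ⟨n, hn, rfl⟩
  have hn1 : 1 ≤ n := hn
  simp only
  rw [Measure.map_apply (hmeas n) hcomp.isClosed.measurableSet.compl]
  set bad : ℕ → Set Ω := fun m => {ω | ¬ DyadicBound (fun x => (visitCount X n x ω : ℝ))
    (Nat.log 4 n) (2 * m + 2) (M m * √n)} with hbad
  refine (measure_mono (t := ⋃ m, bad m) ?_).trans ((measure_iUnion_le _).trans ?_)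
  · intro ω hω
    by_contra hcon
    simp only [hbad, Set.mem_iUnion, Set.mem_ofPred_eq, not_exists, not_not] at hcon
    refine hω ⟨fun m x hx => ((hcon m).localTime_bounds hn1).1 x hx,
      Or.inr (Set.mem_iUnion.2 ⟨n - 1, ?_⟩)⟩
    rw [Nat.sub_add_cancel hn1]
    exact ⟨localTimePath_mem_stepFunctions hn1 ω, Set.mem_iInter₂.2 fun j hj m x y hx hy hxy =>
      ((hcon m).localTime_bounds hn1).2 j hj x y hx hy hxy⟩
  · refine (ENNReal.tsum_le_tsum fun m => ?_).trans hsum.le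
    have h1 := hM m n hn1
    rw [← ofReal_measureReal]
    exact (ENNReal.ofReal_le_ofReal h1).trans (le_of_eq (ENNReal.ofReal_coe_nnreal))
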